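/- For $g\in L^2(\mathbb{R})$ let $\hat g$ be its Fourier transform, normalized by $\hat g(\xi)=\int_{\mathbb{R}} g(t)e^{-2\pi i\xi t}\,dt$ for integrable $g$, and let $G(g)=\{e^{2\pi i nt}g(t-m)\}_{(m,n)\in\mathbb{Z}^2}$ be the Gabor system generated by $g$. We say that $G(g)=\{f_{m,n}\}$ is a Riesz basis with bounds $A,B>0$ if it is complete in $L^2(\mathbb{R})$ (its linear span is dense) and, for every $a\in\ell^2(\mathbb{Z}^2)$, the series $\sum a_{m,n}f_{m,n}$ converges in $L^2(\mathbb{R})$ and $$A\sum|a_{m,n}|^2\le\Big\|\sum a_{m,n}f_{m,n}\Big\|^2\le B\sum|a_{m,n}|^2 .$$ **Theorem.** For all $A,B>0$ there is a constant $C>0$, depending only on $A$ and $B$, such that for every $g\in L^2(\mathbb{R})$ for which $G(g)$ is a Riesz basis with bounds $A,B$, and all $R,L\ge 1$, $$\int_{|t|\ge R}|g(t)|^2\,dt+\int_{|\xi|\ge L}|\hat g(\xi)|^2\,d\xi\ \ge\ \frac{C}{RL}.$$ The result is sharp in the sense that, for large enough $C$, the lower bound cannot be replaced by $C\log(RL)/(RL)$,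 not even for large $R=L$: there are a function $g\in L^2(\mathbb{R})$ for which $G(g)$ is an orthonormal basis of $L^2(\mathbb{R})$ and a constant $C_0>0$ such that, for every $C\ge C_0$ and all $R=L\ge 2$, $$\int_{|t|\ge R}|g(t)|^2\,dt+\int_{|\xi|\ge L}|\hat g(\xi)|^2\,d\xi\ <\ \frac{C\log(RL)}{RL}.$$ -/

import Mathlib

open MeasureTheory
open scoped FourierTransform

/-- The Hilbert space `L²(ℝ)` of complex-valued functions, with Lebesgue measure. -/
abbrev L2R : Type := Lp ℂ 2 (volume : Measure ℝ)

/-- The time-frequency shift `t ↦ e^{2πint} g(t - m)`. -/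
noncomputable def timeFreqShift (g : ℝ → ℂ) (m n : ℤ) : ℝ → ℂ := fun t =>
  Complex.exp (2 * (Real.pi : ℂ) * Complex.I * (n : ℂ) * (t : ℂ)) * g (t - (m : ℝ))

theorem memLp_timeFreqShift {g : ℝ → ℂ} (hg : MemLp g 2 (volume : Measure ℝ)) (m n : ℤ) :
    MemLp (timeFreqShift g m n) 2 (volume : Measure ℝ) := by
  have h1 : MemLp (fun t : ℝ => g (t - (m : ℝ))) 2 (volume : Measure ℝ) :=
    hg.comp_measurePreserving (measurePreserving_sub_right volume (m : ℝ))
  have hc : Continuous (fun t : ℝ =>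
      Complex.exp (2 * (Real.pi : ℂ) * Complex.I * (n : ℂ) * (t : ℂ))) := by fun_prop
  refine h1.of_le (hc.aestronglyMeasurable.mul h1.1) (Filter.Eventually.of_forall fun t => ?_)
  have e : 2 * (Real.pi : ℂ) * Complex.I * (n : ℂ) * (t : ℂ)
      = ((2 * Real.pi * (n : ℝ) * t : ℝ) : ℂ) * Complex.I := by
    push_cast
    ring
  simp only [timeFreqShift]
  rw [norm_mul, e, Complex.norm_exp_ofReal_mul_I, one_mul]

/-- The Gabor system `G(g) = {e^{2πint} g(t - m)}`, indexed by `(m, n) ∈ ℤ²`, in `L²(ℝ)`. -/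
noncomputable def gaborSystem (g : L2R) (p : ℤ × ℤ) : L2R :=
  (memLp_timeFreqShift (Lp.memLp g) p.1 p.2).toLp (timeFreqShift g p.1 p.2)

/-- The family `f` is complete in `H`: its linear span is dense. -/
def IsCompleteSystem {ι H : Type*} [NormedAddCommGroup H] [InnerProductSpace ℂ H]
    (f : ι → H) : Prop :=
  (Submodule.span ℂ (Set.range f)).topologicalClosure = ⊤

/-- `f` is a Riesz basis of `H` for which `A` and `B` are admissible (not necessarily optimal)
positive bounds: `f` is complete and, for every `a ∈ ℓ²`, the series `∑ aᵢ fᵢ` converges and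
`A ∑ |aᵢ|² ≤ ‖∑ aᵢ fᵢ‖² ≤ B ∑ |aᵢ|²`. -/
def IsRieszBasisWithBounds {ι H : Type*} [NormedAddCommGroup H] [InnerProductSpace ℂ H]
    (f : ι → H) (A B : ℝ) : Prop :=
  0 < A ∧ 0 < B ∧ IsCompleteSystem f ∧
    ∀ a : ι → ℂ, Summable (fun i => ‖a i‖ ^ 2) →
      ∃ s : H, HasSum (fun i => a i • f i) s ∧
        A * ∑' i, ‖a i‖ ^ 2 ≤ ‖s‖ ^ 2 ∧ ‖s‖ ^ 2 ≤ B * ∑' i, ‖a i‖ ^ 2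

/-- `f` is an orthonormal basis of `H`: orthonormal and complete. -/
def IsOrthonormalBasis {ι H : Type*} [NormedAddCommGroup H] [InnerProductSpace ℂ H]
    (f : ι → H) : Prop :=
  Orthonormal ℂ f ∧ IsCompleteSystem f

/-- `∫_{|t| ≥ R} |g(t)|² dt + ∫_{|ξ| ≥ L} |ĝ(ξ)|² dξ`, where `ĝ = 𝓕 g` is the Fourier
transform on `L²(ℝ)`, normalized by `ĝ(ξ) = ∫ g(t) e^{-2πiξt} dt` for integrable `g`. -/
noncomputable def timeFreqTail (g : L2R) (R L : ℝ) : ℝ :=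
  (∫ t in {t : ℝ | R ≤ |t|}, ‖g t‖ ^ 2) + ∫ ξ in {ξ : ℝ | L ≤ |ξ|}, ‖(𝓕 g : L2R) ξ‖ ^ 2

/-! The Zak transform identifies `L²(ℝ)` with `L²([0, 1)²)` and turns time-frequency shifts into
multiplication by characters. Hence Riesz bounds `A, B` for `G(g)` force `A ≤ |F|² ≤ B` almost
everywhere for the Zak transform `F` of `g` (`ae_bounds_of_isRieszBasisWithBounds`), while a
unimodular `F` gives an orthonormal basis (`isOrthonormalBasis_gaborSystem`). Extended to the plane,
`F` is quasi-periodic: `F(x + 1, y) = e^{2πiy} F(x, y)` and `F(x, y + 1) = F(x, y)`.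

Lower bound. The phase of a nonvanishing quasi-periodic function has to wind, so on every `N × M`
grid some step between neighbours has relative size at least `3/4` (`exists_large_variation`).
Moving the grid, steps of size comparable to `√A` occur on a set of measure at least `1/(NM)`
(`one_le_mul_measure_of_grid`). A step of length `h` in the first variable multiplies `ĝ` by
`e^{2πihξ} - 1`; in the second, after modulation, it multiplies `g` by `e^{-2πiht} - 1`. These
multipliers are small but not zero near the origin, where the tails give no information. So the
difference is replaced by an `ℓ¹` combination of translates whose multiplier vanishes identically
near the origin and which differs from the difference by at most `ε sup |F|`
(`exists_summable_near_difference`). It exists because `e^{2πiθ} - 1`, cut off to a short interval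
around its zero, has small Wiener norm. Chebyshev's inequality then bounds the measure of the large
steps by the tails, with `N` comparable to `L` and `M` to `R` (`exists_tail_bound`).

Sharpness. Take for `F` the phase of the Zak transform of the hat function, which has a single zero
in the unit square and grows linearly away from it. The phase then varies like the inverse distance
to the zero, so its mean square differences at step `η` are of order at most `η² log(1/η)`. Tails
beyond `R` are dominated by such differences with steps up to `1/R` (`setLIntegral_tail_le`). -/

/-! ### Exponentials and Lebesgue measure on the unit interval and square -/

/-- The exponential `t ↦ e^{2πit}`. -/
noncomputable def expi (t : ℝ) : ℂ := Complex.exp (2 * (Real.pi : ℂ) * Complex.I * (t : ℂ))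

theorem expi_eq (t : ℝ) : expi t = Complex.exp (((2 * Real.pi * t : ℝ) : ℂ) * Complex.I) := by
  unfold expi; congr 1; push_cast; ring

@[simp] theorem norm_expi (t : ℝ) : ‖expi t‖ = 1 := by
  rw [expi_eq, Complex.norm_exp_ofReal_mul_I]

@[simp] theorem enorm_expi (t : ℝ) : ‖expi t‖ₑ = 1 := by
  rw [← ofReal_norm, norm_expi, ENNReal.ofReal_one]

theorem expi_ne_zero (t : ℝ) : expi t ≠ 0 := Complex.exp_ne_zero _

@[simp] theorem expi_zero : expi 0 = 1 := by simp [expi]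

theorem expi_add (s t : ℝ) : expi (s + t) = expi s * expi t := by
  unfold expi; rw [← Complex.exp_add]; congr 1; push_cast; ring

@[simp] theorem expi_intCast (n : ℤ) : expi n = 1 := by
  unfold expi
  rw [Complex.exp_eq_one_iff]
  exact ⟨n, by push_cast; ring⟩

theorem expi_add_intCast (t : ℝ) (n : ℤ) : expi (t + n) = expi t := by
  rw [expi_add, expi_intCast, mul_one]

@[fun_prop] theorem continuous_expi : Continuous expi := by unfold expi; fun_prop

@[fun_prop] theorem measurable_expi : Measurable expi := continuous_expi.measurable

theorem fourier_coe_eq_expi (n : ℤ) (x : ℝ) : fourier n (x : AddCircle (1 : ℝ)) = expi (n * x) := by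
  rw [fourier_coe_apply]; unfold expi; congr 1; push_cast; ring

/-- Lebesgue measure on `[0, 1)`. -/
noncomputable def unitMeasure : Measure ℝ := volume.restrict (Set.Ico 0 1)

theorem unitMeasure_eq_Ioc : unitMeasure = volume.restrict (Set.Ioc 0 1) :=
  restrict_Ico_eq_restrict_Ioc

instance : IsProbabilityMeasure unitMeasure := ⟨by simp [unitMeasure]⟩

/-- Lebesgue measure on `[0, 1)²`. -/
noncomputable def squareMeasure : Measure (ℝ × ℝ) := unitMeasure.prod unitMeasure

instance : IsProbabilityMeasure squareMeasure := by unfold squareMeasure; infer_instance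

theorem squareMeasure_eq_restrict :
    squareMeasure = volume.restrict (Set.Ico 0 1 ×ˢ Set.Ico 0 1) := by
  rw [squareMeasure, unitMeasure, Measure.prod_restrict]; rfl

theorem ae_unitMeasure_mem : ∀ᵐ x ∂unitMeasure, x ∈ Set.Ico (0 : ℝ) 1 :=
  ae_restrict_mem measurableSet_Ico

theorem integral_unitMeasure (f : ℝ → ℂ) : ∫ y, f y ∂unitMeasure = ∫ y in (0 : ℝ)..1, f y := by
  rw [intervalIntegral.integral_of_le zero_le_one, unitMeasure_eq_Ioc]

theorem lintegral_enorm_sq_eq_ofReal {α E : Type*} [MeasurableSpace α] [NormedAddCommGroup E]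
    {μ : Measure α} {f : α → E} (hf : MemLp f 2 μ) :
    ∫⁻ x, ‖f x‖ₑ ^ 2 ∂μ = ENNReal.ofReal (∫ x, ‖f x‖ ^ 2 ∂μ) := by
  have hi : Integrable (fun x => ‖f x‖ ^ 2) μ := by simpa using hf.integrable_norm_pow two_ne_zero
  rw [ofReal_integral_eq_lintegral_ofReal hi (Filter.Eventually.of_forall fun x => by positivity)]
  refine lintegral_congr fun x => ?_
  rw [ENNReal.ofReal_pow (norm_nonneg _), ofReal_norm]

/-- Parseval's identity on `[0, 1)`. -/
theorem tsum_enorm_integral_expi_sq {f : ℝ → ℂ} (hf : MemLp f 2 unitMeasure) :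
    ∑' k : ℤ, ‖∫ y, expi (k * y) * f y ∂unitMeasure‖ₑ ^ 2 = ∫⁻ y, ‖f y‖ₑ ^ 2 ∂unitMeasure := by
  rw [lintegral_enorm_sq_eq_ofReal hf]
  have hf' := hf
  rw [unitMeasure_eq_Ioc] at hf'
  have h := hasSum_sq_fourierCoeffOn (zero_lt_one' ℝ) hf'
  rw [sub_zero, inv_one, one_smul, intervalIntegral.integral_of_le zero_le_one,
    ← unitMeasure_eq_Ioc] at h
  rw [← h.tsum_eq, ENNReal.ofReal_tsum_of_nonneg (fun _ => by positivity) h.summable,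
    ← (Equiv.neg ℤ).tsum_eq]
  refine tsum_congr fun k => ?_
  rw [ENNReal.ofReal_pow (norm_nonneg _), ofReal_norm, fourierCoeffOn_eq_integral]
  congr 2
  rw [integral_unitMeasure]
  simp only [sub_zero, div_one, one_smul, Equiv.neg_apply]
  refine intervalIntegral.integral_congr fun y _ => ?_
  have := fourier_coe_eq_expi (-k) y
  simp only [smul_eq_mul]
  norm_num at this ⊢
  left
  rw [this]

theorem lintegral_eq_tsum_unitMeasure (f : ℝ → ENNReal) :
    ∫⁻ t, f t = ∑' k : ℤ, ∫⁻ x, f (x + k) ∂unitMeasure := by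
  rw [← setLIntegral_univ, ← iUnion_Ico_intCast ℝ,
    lintegral_iUnion (fun _ => measurableSet_Ico) (Set.pairwise_disjoint_Ico_intCast ℝ)]
  refine tsum_congr fun k => ?_
  have h := (measurePreserving_add_right (volume : Measure ℝ) (k : ℝ)).setLIntegral_comp_preimage_emb
    (measurableEmbedding_addRight _) f (Set.Ico (k : ℝ) (k + 1))
  rw [← h, unitMeasure]
  congr 2
  ext x
  simp

theorem floor_add_of_mem_Ico {x : ℝ} (hx : x ∈ Set.Ico (0 : ℝ) 1) (k : ℤ) : ⌊x + k⌋ = k := by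
  rw [Int.floor_add_intCast, Int.floor_eq_zero_iff.2 hx, zero_add]

theorem fract_add_of_mem_Ico {x : ℝ} (hx : x ∈ Set.Ico (0 : ℝ) 1) (k : ℤ) :
    Int.fract (x + k) = x := by
  rw [Int.fract_add_intCast, Int.fract_eq_self.2 hx]

/-- Transfers almost-everywhere statements on `[0, 1)` to almost every real `t`: the preimage of a
null set is a countable union of integer translates of null sets. -/
theorem quasiMeasurePreserving_fract :
    Measure.QuasiMeasurePreserving (Int.fract : ℝ → ℝ) volume unitMeasure := by
  refine ⟨measurable_fract, Measure.AbsolutelyContinuous.mk fun s hs h0 => ?_⟩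
  rw [Measure.map_apply measurable_fract hs, ← lintegral_indicator_one (measurable_fract hs),
    lintegral_eq_tsum_unitMeasure]
  refine ENNReal.tsum_eq_zero.2 fun k => ?_
  rw [← h0, ← lintegral_indicator_one hs]
  refine lintegral_congr_ae ?_
  filter_upwards [ae_unitMeasure_mem] with x hx
  by_cases hs : x ∈ s <;> simp [Set.indicator, hs, Int.fract_eq_self.2 hx]

/-! ### The inverse Zak transform is unitary -/

/-- The inverse Zak transform of a function on `[0, 1)²`. -/
noncomputable def zakInv (F : ℝ × ℝ → ℂ) (t : ℝ) : ℂ :=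
  ∫ y, expi (⌊t⌋ * y) * F (Int.fract t, y) ∂unitMeasure

theorem zakInv_congr_ae {F G : ℝ × ℝ → ℂ} (h : F =ᵐ[squareMeasure] G) :
    zakInv F =ᵐ[volume] zakInv G := by
  have h1 : ∀ᵐ x ∂unitMeasure, ∀ᵐ y ∂unitMeasure, F (x, y) = G (x, y) :=
    Measure.ae_ae_of_ae_prod h
  filter_upwards [quasiMeasurePreserving_fract.ae h1] with t ht
  refine integral_congr_ae ?_
  filter_upwards [ht] with y hy
  rw [hy]

theorem stronglyMeasurable_zakInv {F : ℝ × ℝ → ℂ} (hF : StronglyMeasurable F) :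
    StronglyMeasurable (zakInv F) := by
  have h : StronglyMeasurable (fun p : ℝ × ℝ => expi (⌊p.1⌋ * p.2) * F (Int.fract p.1, p.2)) := by
    refine StronglyMeasurable.mul ?_ (hF.comp_measurable (by fun_prop))
    refine (Measurable.stronglyMeasurable ?_)
    have : Measurable (fun p : ℝ × ℝ => ((⌊p.1⌋ : ℤ) : ℝ)) :=
      measurable_from_top.comp (Int.measurable_floor.comp measurable_fst)
    fun_prop
  exact h.integral_prod_right

theorem lintegral_squareMeasure {f : ℝ × ℝ → ENNReal} (hf : AEMeasurable f squareMeasure) :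
    ∫⁻ p, f p ∂squareMeasure = ∫⁻ x, ∫⁻ y, f (x, y) ∂unitMeasure ∂unitMeasure :=
  lintegral_prod _ hf

theorem memLp_two_iff_lintegral {α : Type*} [MeasurableSpace α] {μ : Measure α} {f : α → ℂ}
    (hf : AEStronglyMeasurable f μ) : MemLp f 2 μ ↔ ∫⁻ x, ‖f x‖ₑ ^ 2 ∂μ < ⊤ := by
  rw [MemLp, and_iff_right hf, eLpNorm_lt_top_iff_lintegral_rpow_enorm_lt_top (by simp) (by simp)]
  simp

theorem enorm_toLp_sq {α : Type*} [MeasurableSpace α] {μ : Measure α} {f : α → ℂ}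
    (hf : MemLp f 2 μ) : ‖hf.toLp f‖ₑ ^ 2 = ∫⁻ x, ‖f x‖ₑ ^ 2 ∂μ := by
  rw [Lp.enorm_toLp, eLpNorm_eq_lintegral_rpow_enorm_toReal (by simp) (by simp)]
  rw [← ENNReal.rpow_natCast, ← ENNReal.rpow_mul]
  simp

theorem enorm_Lp_sq {α : Type*} [MeasurableSpace α] {μ : Measure α} (f : Lp ℂ 2 μ) :
    ‖f‖ₑ ^ 2 = ∫⁻ x, ‖f x‖ₑ ^ 2 ∂μ := by
  rw [← enorm_toLp_sq (Lp.memLp f), Lp.toLp_coeFn]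

theorem ae_memLp_slice {F : ℝ × ℝ → ℂ} (hF : StronglyMeasurable F) (h2 : MemLp F 2 squareMeasure) :
    ∀ᵐ x ∂unitMeasure, MemLp (fun y => F (x, y)) 2 unitMeasure := by
  have h := (memLp_two_iff_lintegral hF.aestronglyMeasurable).1 h2
  rw [lintegral_squareMeasure (hF.enorm.pow_const 2).aemeasurable] at h
  have := ae_lt_top' (Measurable.aemeasurable
    (hF.enorm.pow_const 2).lintegral_prod_right') h.ne
  filter_upwards [this] with x hx
  exact (memLp_two_iff_lintegral
    (hF.comp_measurable measurable_prodMk_left).aestronglyMeasurable).2 hx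

/-- For fixed `x`, the values at `x + k` are the Fourier coefficients of the slice `F (x, ·)`;
Parseval in `y`, then integration in `x`. -/
theorem lintegral_zakInv {F : ℝ × ℝ → ℂ} (hF : StronglyMeasurable F)
    (h2 : MemLp F 2 squareMeasure) :
    ∫⁻ t, ‖zakInv F t‖ₑ ^ 2 = ∫⁻ p, ‖F p‖ₑ ^ 2 ∂squareMeasure := by
  have hm (k : ℤ) : AEMeasurable (fun x => ‖zakInv F (x + k)‖ₑ ^ 2) unitMeasure :=
    (((stronglyMeasurable_zakInv hF).comp_measurable
      (measurable_add_const (k : ℝ))).enorm.pow_const 2).aemeasurable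
  rw [lintegral_eq_tsum_unitMeasure, lintegral_squareMeasure (hF.enorm.pow_const 2).aemeasurable,
    ← lintegral_tsum hm]
  refine lintegral_congr_ae ?_
  filter_upwards [ae_unitMeasure_mem, ae_memLp_slice hF h2] with x hx hx2
  rw [← tsum_enorm_integral_expi_sq hx2]
  refine tsum_congr fun k => ?_
  simp only [zakInv, floor_add_of_mem_Ico hx, fract_add_of_mem_Ico hx]

theorem memLp_zakInv {F : ℝ × ℝ → ℂ} (hF : StronglyMeasurable F) (h2 : MemLp F 2 squareMeasure) :
    MemLp (zakInv F) 2 volume := by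
  rw [memLp_two_iff_lintegral (stronglyMeasurable_zakInv hF).aestronglyMeasurable,
    lintegral_zakInv hF h2]
  exact (memLp_two_iff_lintegral hF.aestronglyMeasurable).1 h2

theorem ae_integrable_fract {F : ℝ × ℝ → ℂ} (hF : StronglyMeasurable F)
    (h2 : MemLp F 2 squareMeasure) :
    ∀ᵐ t : ℝ, Integrable (fun y => expi (⌊t⌋ * y) * F (Int.fract t, y)) unitMeasure := by
  filter_upwards [quasiMeasurePreserving_fract.ae (ae_memLp_slice hF h2)] with t ht
  refine (ht.integrable one_le_two).bdd_mul (c := 1) ?_ (by simp)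
  exact Measurable.aestronglyMeasurable (by fun_prop)

/-- The inverse Zak transform as a linear isometry. -/
noncomputable def zakInvIsometry : Lp ℂ 2 squareMeasure →ₗᵢ[ℂ] L2R where
  toFun f := (memLp_zakInv (Lp.stronglyMeasurable f) (Lp.memLp f)).toLp (zakInv f)
  map_add' f g := by
    rw [← MemLp.toLp_add (memLp_zakInv (Lp.stronglyMeasurable f) (Lp.memLp f))
      (memLp_zakInv (Lp.stronglyMeasurable g) (Lp.memLp g))]
    refine (MemLp.toLp_eq_toLp_iff _ _).2 ?_
    refine (zakInv_congr_ae (Lp.coeFn_add f g)).trans ?_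
    filter_upwards [ae_integrable_fract (Lp.stronglyMeasurable f) (Lp.memLp f),
      ae_integrable_fract (Lp.stronglyMeasurable g) (Lp.memLp g)] with t hf hg
    simp only [zakInv, Pi.add_apply, mul_add]
    exact integral_add hf hg
  map_smul' c f := by
    rw [RingHom.id_apply,
      ← MemLp.toLp_const_smul c (f := zakInv f) (memLp_zakInv (Lp.stronglyMeasurable f) (Lp.memLp f))]
    refine (MemLp.toLp_eq_toLp_iff _ _).2 ?_
    refine (zakInv_congr_ae (Lp.coeFn_smul c f)).trans ?_
    refine Filter.Eventually.of_forall fun t => ?_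
    simp only [zakInv, Pi.smul_apply, smul_eq_mul, mul_left_comm _ c, integral_const_mul]
  norm_map' f := by
    have h : ‖(memLp_zakInv (Lp.stronglyMeasurable f) (Lp.memLp f)).toLp (zakInv f)‖ₑ ^ 2
        = ‖f‖ₑ ^ 2 := by
      rw [enorm_toLp_sq (memLp_zakInv (Lp.stronglyMeasurable f) (Lp.memLp f)), enorm_Lp_sq,
        lintegral_zakInv (Lp.stronglyMeasurable f) (Lp.memLp f)]
    have h' := (ENNReal.pow_right_strictMono two_ne_zero).injective h
    simpa using congrArg ENNReal.toReal h'

theorem zakInvIsometry_coeFn (f : Lp ℂ 2 squareMeasure) : zakInvIsometry f =ᵐ[volume] zakInv f :=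
  MemLp.coeFn_toLp (memLp_zakInv (Lp.stronglyMeasurable f) (Lp.memLp f))

theorem zakInvIsometry_toLp_coeFn {F : ℝ × ℝ → ℂ} (hF : MemLp F 2 squareMeasure) :
    zakInvIsometry (hF.toLp F) =ᵐ[volume] zakInv F :=
  (zakInvIsometry_coeFn _).trans (zakInv_congr_ae hF.coeFn_toLp)

theorem integral_expi_intCast_mul (k : ℤ) :
    ∫ y, expi (k * y) ∂unitMeasure = if k = 0 then 1 else 0 := by
  have h := congrFun (fourierCoeff_fourier (T := 1) k) 0
  rw [fourierCoeff_eq_intervalIntegral _ _ 0] at h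
  rw [integral_unitMeasure]
  simp only [zero_add, neg_zero, div_one, one_smul, fourier_zero, Pi.single_apply] at h
  simp only [← fourier_coe_eq_expi]
  rw [h]
  simp [eq_comm]

/-- Exhibits the restriction of `h` to each `[m, m + 1)` as an inverse Zak transform, which is what
surjectivity needs. -/
theorem zakInv_eq_indicator (h : ℝ → ℂ) (m : ℤ) (t : ℝ) :
    zakInv (fun p => expi (-m * p.2) * h (p.1 + m)) t
      = (Set.Ico (m : ℝ) (m + 1)).indicator h t := by
  have e : ∀ y : ℝ, expi (⌊t⌋ * y) * (expi (-m * y) * h (Int.fract t + m))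
      = expi (((⌊t⌋ - m : ℤ) : ℝ) * y) * h (Int.fract t + m) := by
    intro y
    rw [← mul_assoc, ← expi_add]
    congr 2
    push_cast
    ring
  simp only [zakInv, e, integral_mul_const, integral_expi_intCast_mul, Set.indicator]
  by_cases hm : ⌊t⌋ = m
  · have : t ∈ Set.Ico (m : ℝ) (m + 1) := by exact Int.floor_eq_iff.1 hm
    rw [if_pos (by omega), if_pos this, one_mul, ← hm, Int.fract_add_floor]
  · have : t ∉ Set.Ico (m : ℝ) (m + 1) := fun h' => hm (Int.floor_eq_iff.2 h')
    rw [if_neg (by omega), if_neg this, zero_mul]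

/-- The range of an isometry of complete spaces is closed, so a trivial orthogonal complement
suffices. The range contains the restriction of `h` to each `[m, m + 1)`; if `h` is orthogonal to
the range, each restriction has norm zero. -/
theorem zakInvIsometry_surjective : Function.Surjective zakInvIsometry := by
  have hclosed : IsClosed (LinearMap.range zakInvIsometry.toLinearMap : Set L2R) := by
    have := zakInvIsometry.isometry.isClosedEmbedding.isClosed_range
    rwa [← LinearIsometry.coe_toLinearMap, ← LinearMap.coe_range] at this
  have : CompleteSpace (LinearMap.range zakInvIsometry.toLinearMap) :=
    hclosed.completeSpace_coe
  suffices hbot : (LinearMap.range zakInvIsometry.toLinearMap)ᗮ = ⊥ by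
    have := (Submodule.orthogonal_eq_bot_iff).1 hbot
    exact LinearMap.range_eq_top.1 this
  rw [Submodule.eq_bot_iff]
  intro h hh
  have hsm := Lp.stronglyMeasurable h
  have key : ∀ m : ℤ, ∀ᵐ t : ℝ, (Set.Ico (m : ℝ) (m + 1)).indicator h t = 0 := by
    intro m
    have hFm : StronglyMeasurable (fun p : ℝ × ℝ => expi (-m * p.2) * h (p.1 + m)) := by
      refine StronglyMeasurable.mul (Measurable.stronglyMeasurable (by fun_prop)) ?_
      exact hsm.comp_measurable (by fun_prop)
    have hF2 : MemLp (fun p : ℝ × ℝ => expi (-m * p.2) * h (p.1 + m)) 2 squareMeasure := by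
      rw [memLp_two_iff_lintegral hFm.aestronglyMeasurable,
        lintegral_squareMeasure (hFm.enorm.pow_const 2).aemeasurable]
      simp only [enorm_mul, enorm_expi, one_mul, lintegral_const, measure_univ, mul_one]
      calc ∫⁻ x, ‖h (x + m)‖ₑ ^ 2 ∂unitMeasure
          ≤ ∑' k : ℤ, ∫⁻ x, ‖h (x + k)‖ₑ ^ 2 ∂unitMeasure :=
            ENNReal.le_tsum (f := fun k : ℤ => ∫⁻ x, ‖h (x + k)‖ₑ ^ 2 ∂unitMeasure) m
        _ = ∫⁻ t, ‖h t‖ₑ ^ 2 := (lintegral_eq_tsum_unitMeasure (fun t => ‖h t‖ₑ ^ 2)).symm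
        _ < ⊤ := (memLp_two_iff_lintegral hsm.aestronglyMeasurable).1 (Lp.memLp h)
    set u := zakInvIsometry (hF2.toLp _) with hu
    have hue : u =ᵐ[volume] (Set.Ico (m : ℝ) (m + 1)).indicator h := by
      refine (zakInvIsometry_toLp_coeFn hF2).trans ?_
      exact Filter.Eventually.of_forall fun t => zakInv_eq_indicator h m t
    have h0 : inner ℂ u h = 0 := (Submodule.mem_orthogonal _ _).1 hh u ⟨_, rfl⟩
    have h1 : inner ℂ u u = 0 := by
      rw [← h0, L2.inner_def, L2.inner_def]
      refine integral_congr_ae ?_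
      filter_upwards [hue] with t ht
      rw [ht]
      by_cases hm : t ∈ Set.Ico (m : ℝ) (m + 1) <;> simp [Set.indicator, hm]
    have h2 : u = 0 := inner_self_eq_zero.1 h1
    rw [h2] at hue
    filter_upwards [hue, Lp.coeFn_zero ℂ 2 (volume : Measure ℝ)] with t ht ht0
    rw [← ht, ht0, Pi.zero_apply]
  refine (Lp.eq_zero_iff_ae_eq_zero).2 ?_
  filter_upwards [ae_all_iff.2 key] with t ht
  have h1 := ht ⌊t⌋
  rwa [Set.indicator_of_mem (show t ∈ Set.Ico (⌊t⌋ : ℝ) (⌊t⌋ + 1) from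
    ⟨Int.floor_le t, Int.lt_floor_add_one t⟩)] at h1

/-- The inverse Zak transform as a unitary map. -/
noncomputable def zakInvEquiv : Lp ℂ 2 squareMeasure ≃ₗᵢ[ℂ] L2R :=
  LinearIsometryEquiv.ofSurjective zakInvIsometry zakInvIsometry_surjective

theorem zakInvEquiv_toLp_coeFn {F : ℝ × ℝ → ℂ} (hF : MemLp F 2 squareMeasure) :
    zakInvEquiv (hF.toLp F) =ᵐ[volume] zakInv F :=
  zakInvIsometry_toLp_coeFn hF

/-! ### Identifying `L²` limits pointwise -/

/-- Products with a fixed function pass to `L²` limits. -/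
theorem ae_eq_mul_of_tendsto {α ι : Type*} [MeasurableSpace α] {μ : Measure α} {l : Filter ι}
    [l.NeBot] [l.IsCountablyGenerated] {u v : ι → Lp ℂ 2 μ} {u₀ v₀ : Lp ℂ 2 μ} {f : α → ℂ}
    (hu : Filter.Tendsto u l (nhds u₀)) (hv : Filter.Tendsto v l (nhds v₀))
    (h : ∀ i, v i =ᵐ[μ] fun x => f x * u i x) : v₀ =ᵐ[μ] fun x => f x * u₀ x := by
  -- Convergence in `L²` gives almost everywhere convergence only along a subsequence; the second
  -- one is extracted from the first so that both limits hold together.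
  obtain ⟨ns, hns, h1⟩ := (tendstoInMeasure_of_tendsto_Lp hu).exists_seq_tendsto_ae'
  obtain ⟨ms, hms, h2⟩ := (tendstoInMeasure_of_tendsto_Lp (hv.comp hns)).exists_seq_tendsto_ae'
  filter_upwards [h1, h2, ae_all_iff.2 fun k => h (ns k)] with x hx1 hx2 hx3
  refine tendsto_nhds_unique hx2 (((hx1.comp hms).const_mul (f x)).congr fun k => ?_)
  exact (hx3 (ms k)).symm

/-- An `L²`-sum agrees almost everywhere with the pointwise sum. -/
theorem ae_eq_of_hasSum_of_hasSum {α ι : Type*} [Countable ι] [MeasurableSpace α] {μ : Measure α}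
    {u : ι → Lp ℂ 2 μ} {s : Lp ℂ 2 μ} {f : ι → α → ℂ} {w : α → ℂ}
    (hu : HasSum u s) (hf : ∀ i, u i =ᵐ[μ] f i) (hw : ∀ᵐ x ∂μ, HasSum (fun i => f i x) (w x)) :
    s =ᵐ[μ] w := by
  obtain ⟨ns, hns, h1⟩ := (tendstoInMeasure_of_tendsto_Lp hu).exists_seq_tendsto_ae'
  have h2 : ∀ᵐ x ∂μ, ∀ k, (∑ i ∈ ns k, u i : Lp ℂ 2 μ) x = ∑ i ∈ ns k, f i x := by
    refine ae_all_iff.2 fun k => ?_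
    filter_upwards [Lp.coeFn_finsetSum (ns k) u, ae_all_iff.2 hf] with x hx1 hx2
    rw [hx1, Finset.sum_apply]
    exact Finset.sum_congr rfl fun i _ => hx2 i
  filter_upwards [h1, h2, hw] with x hx1 hx2 hx3
  exact tendsto_nhds_unique hx1 ((hx3.comp hns).congr fun k => (hx2 k).symm)

/-! ### Characters as a Hilbert basis of the square -/

/-- The character of `ℝ²` that corresponds to the time-frequency shift by `p`. -/
noncomputable def squareChar (p : ℤ × ℤ) (z : ℝ × ℝ) : ℂ :=
  expi (p.2 * z.1) * expi (-p.1 * z.2)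

@[fun_prop] theorem continuous_squareChar (p : ℤ × ℤ) : Continuous (squareChar p) := by
  unfold squareChar; fun_prop

@[simp] theorem norm_squareChar (p : ℤ × ℤ) (z : ℝ × ℝ) : ‖squareChar p z‖ = 1 := by
  simp [squareChar]

theorem memLp_squareChar_mul (p : ℤ × ℤ) {F : ℝ × ℝ → ℂ} (hF : MemLp F 2 squareMeasure) :
    MemLp (fun z => squareChar p z * F z) 2 squareMeasure := by
  refine hF.of_le ((continuous_squareChar p).aestronglyMeasurable.mul hF.1)
    (Filter.Eventually.of_forall fun z => ?_)
  simp

theorem memLp_squareChar (p : ℤ × ℤ) : MemLp (squareChar p) 2 squareMeasure := by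
  simpa using memLp_squareChar_mul p (memLp_const (1 : ℂ))

section Torus

attribute [local instance] instMeasureSpaceUnitAddCircle

instance : IsProbabilityMeasure (volume : Measure UnitAddCircle) :=
  inferInstanceAs (IsProbabilityMeasure AddCircle.haarAddCircle)

theorem measurePreserving_coe_unitAddCircle :
    MeasurePreserving ((↑) : ℝ → UnitAddCircle) unitMeasure volume := by
  have h := AddCircle.measurePreserving_mk 1 0
  rw [zero_add, ← unitMeasure_eq_Ioc, AddCircle.volume_eq_smul_haarAddCircle, ENNReal.ofReal_one,
    one_smul] at h
  exact h

/-- The covering map of the torus. -/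
noncomputable def toTorus (z : ℝ × ℝ) : UnitAddTorus (Fin 2) := ![(z.1 : UnitAddCircle), z.2]

theorem measurePreserving_toTorus : MeasurePreserving toTorus squareMeasure volume := by
  have h2 : MeasurePreserving (Prod.map ((↑) : ℝ → UnitAddCircle) ((↑) : ℝ → UnitAddCircle))
      squareMeasure (volume : Measure (UnitAddCircle × UnitAddCircle)) := 
    measurePreserving_coe_unitAddCircle.prod measurePreserving_coe_unitAddCircle
  exact (volume_preserving_finTwoArrow UnitAddCircle).symm.comp h2

/-- A measurable section of the covering map of the torus. -/
noncomputable def ofTorus (θ : UnitAddTorus (Fin 2)) : ℝ × ℝ :=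
  ((AddCircle.equivIco 1 0 (θ 0) : ℝ), (AddCircle.equivIco 1 0 (θ 1) : ℝ))

theorem measurable_ofTorus : Measurable ofTorus := by
  have h : Measurable (fun a : UnitAddCircle => (AddCircle.equivIco 1 0 a : ℝ)) :=
    measurable_subtype_coe.comp (AddCircle.measurableEquivIco 1 0).measurable
  exact (h.comp (measurable_pi_apply 0)).prodMk (h.comp (measurable_pi_apply 1))

theorem ae_squareMeasure_mem :
    ∀ᵐ z ∂squareMeasure, z.1 ∈ Set.Ico (0 : ℝ) 1 ∧ z.2 ∈ Set.Ico (0 : ℝ) 1 := by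
  rw [squareMeasure_eq_restrict]
  exact ae_restrict_mem (measurableSet_Ico.prod measurableSet_Ico)

theorem ofTorus_toTorus : ∀ᵐ z ∂squareMeasure, ofTorus (toTorus z) = z := by
  filter_upwards [ae_squareMeasure_mem] with z hz
  have h (x : ℝ) (hx : x ∈ Set.Ico (0 : ℝ) 1) :
      (AddCircle.equivIco 1 0 (x : AddCircle (1 : ℝ)) : ℝ) = x := by
    rw [AddCircle.equivIco_coe_of_mem (by simpa using hx)]
  exact Prod.ext (h _ hz.1) (h _ hz.2)

theorem measurePreserving_ofTorus : MeasurePreserving ofTorus volume squareMeasure := by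
  refine ⟨measurable_ofTorus, ?_⟩
  rw [← measurePreserving_toTorus.map_eq,
    Measure.map_map measurable_ofTorus measurePreserving_toTorus.measurable,
    Measure.map_congr (f := ofTorus ∘ toTorus) (g := id) ofTorus_toTorus, Measure.map_id]

/-- Pullback along the covering map of the torus. -/
noncomputable def torusPullback :
    Lp ℂ 2 (volume : Measure (UnitAddTorus (Fin 2))) →ₗᵢ[ℂ] Lp ℂ 2 squareMeasure :=
  Lp.compMeasurePreservingₗᵢ ℂ toTorus measurePreserving_toTorus

theorem torusPullback_surjective : Function.Surjective torusPullback := by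
  intro f
  refine ⟨Lp.compMeasurePreserving ofTorus measurePreserving_ofTorus f, Lp.ext ?_⟩
  have h1 : torusPullback (Lp.compMeasurePreserving ofTorus measurePreserving_ofTorus f)
      =ᵐ[squareMeasure] _ := Lp.coeFn_compMeasurePreserving _ measurePreserving_toTorus
  have h2 := measurePreserving_toTorus.quasiMeasurePreserving.ae
    (Lp.coeFn_compMeasurePreserving f measurePreserving_ofTorus)
  filter_upwards [h1, h2, ofTorus_toTorus] with z hz1 hz2 hz3
  rw [hz1, Function.comp_apply, hz2, Function.comp_apply, hz3]

/-- The frequency on the torus that corresponds to the time-frequency shift by `p`. -/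
def torusFreq (p : ℤ × ℤ) : Fin 2 → ℤ := ![p.2, -p.1]

theorem torusFreq_injective : Function.Injective torusFreq := by
  rintro ⟨a, b⟩ ⟨c, d⟩ h
  have h0 := congrFun h 0
  have h1 := congrFun h 1
  simp [torusFreq] at h0 h1
  exact Prod.ext h1 h0

theorem torusFreq_surjective : Function.Surjective torusFreq := by
  intro v
  refine ⟨(-v 1, v 0), ?_⟩
  ext i
  fin_cases i <;> simp [torusFreq]

theorem torusPullback_mFourierLp (p : ℤ × ℤ) :
    torusPullback (UnitAddTorus.mFourierLp 2 (torusFreq p))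
      = (memLp_squareChar p).toLp (squareChar p) := by
  refine Lp.ext ?_
  have h1 : torusPullback (UnitAddTorus.mFourierLp 2 (torusFreq p))
      =ᵐ[squareMeasure] _ := Lp.coeFn_compMeasurePreserving _ measurePreserving_toTorus
  have h2 := measurePreserving_toTorus.quasiMeasurePreserving.ae
    (UnitAddTorus.coeFn_mFourierLp 2 (torusFreq p))
  filter_upwards [h1, h2, (memLp_squareChar p).coeFn_toLp] with z hz1 hz2 hz3
  rw [hz1, Function.comp_apply, hz2, hz3]
  simp only [UnitAddTorus.mFourier, ContinuousMap.coe_mk, Fin.prod_univ_two, squareChar]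
  have h0 := fourier_coe_eq_expi p.2 z.1
  have h1 := fourier_coe_eq_expi (-p.1) z.2
  rw [Int.cast_neg] at h1
  exact congrArg₂ (· * ·) h0 h1

/-- The characters form a Hilbert basis of `L²([0, 1)²)`. -/
noncomputable def squareBasis : HilbertBasis (ℤ × ℤ) ℂ (Lp ℂ 2 squareMeasure) :=
  HilbertBasis.mk (v := fun p => (memLp_squareChar p).toLp (squareChar p))
    (by
      simp only [← torusPullback_mFourierLp]
      exact (UnitAddTorus.orthonormal_mFourier.comp _ torusFreq_injective).comp_linearIsometry
        torusPullback)
    (by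
      have h1 := UnitAddTorus.span_mFourierLp_closure_eq_top (d := Fin 2) (p := 2) (by simp)
      -- Density of the trigonometric polynomials is known on the torus, and a surjective continuous
      -- linear map preserves density of a subspace.
      have h2 := torusPullback_surjective.denseRange.topologicalClosure_map_submodule
        (f := torusPullback.toContinuousLinearMap) h1
      rw [← h2, Submodule.map_span, ← Set.range_comp]
      refine le_of_eq ?_
      congr 2
      rw [← torusFreq_surjective.range_comp]
      congr 1
      funext p
      exact torusPullback_mFourierLp p)

theorem squareBasis_apply (p : ℤ × ℤ) :
    squareBasis p = (memLp_squareChar p).toLp (squareChar p) := by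
  simp [squareBasis]

end Torus

/-! ### Gabor systems under the Zak transform -/

/-- Modulation by an integer frequency sees only the fractional part of `t`, and translation by an
integer changes only `⌊t⌋`; each therefore contributes one factor of the character. -/
theorem timeFreqShift_zakInv (F : ℝ × ℝ → ℂ) (p : ℤ × ℤ) :
    timeFreqShift (zakInv F) p.1 p.2 = zakInv fun z => squareChar p z * F z := by
  funext t
  have h0 : Complex.exp (2 * (Real.pi : ℂ) * Complex.I * (p.2 : ℂ) * (t : ℂ))
      = expi (p.2 * Int.fract t) := by
    have : (p.2 : ℝ) * Int.fract t = p.2 * t + ((-(p.2 * ⌊t⌋) : ℤ) : ℝ) := by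
      rw [Int.fract]; push_cast; ring
    rw [this, expi_add_intCast]
    unfold expi
    congr 1
    push_cast
    ring
  simp only [timeFreqShift, zakInv, h0, Int.floor_sub_intCast, Int.fract_sub_intCast, squareChar]
  rw [← integral_const_mul]
  refine integral_congr_ae (Filter.Eventually.of_forall fun y => ?_)
  have h1 : expi (((⌊t⌋ - p.1 : ℤ) : ℝ) * y) = expi (⌊t⌋ * y) * expi (-p.1 * y) := by
    rw [← expi_add]; congr 1; push_cast; ring
  simp only [h1]
  ring

theorem timeFreqShift_congr_ae {f g : ℝ → ℂ} (h : f =ᵐ[volume] g) (m n : ℤ) :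
    timeFreqShift f m n =ᵐ[volume] timeFreqShift g m n := by
  filter_upwards [(measurePreserving_sub_right volume (m : ℝ)).quasiMeasurePreserving.ae h]
    with t ht
  simp only [timeFreqShift, ht]

theorem gaborSystem_zakInvEquiv (f : Lp ℂ 2 squareMeasure) (p : ℤ × ℤ) :
    gaborSystem (zakInvEquiv f) p
      = zakInvEquiv ((memLp_squareChar_mul p (Lp.memLp f)).toLp _) := by
  refine Lp.ext ?_
  refine (MemLp.coeFn_toLp _).trans ?_
  refine Filter.EventuallyEq.trans ?_ (zakInvEquiv_toLp_coeFn _).symm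
  rw [← timeFreqShift_zakInv]
  exact timeFreqShift_congr_ae (zakInvIsometry_coeFn f) _ _

/-- Take as coefficients those of the indicator of `E` in the basis of characters. Their square sum
is the measure of `E`, and the Gabor series with these coefficients is the inverse Zak transform of
`f` times the indicator. -/
theorem setLIntegral_le_of_isRieszBasisWithBounds {f : Lp ℂ 2 squareMeasure} {A B : ℝ}
    (h : IsRieszBasisWithBounds (gaborSystem (zakInvEquiv f)) A B) {E : Set (ℝ × ℝ)}
    (hE : MeasurableSet E) :
    ENNReal.ofReal A * squareMeasure E ≤ ∫⁻ z in E, ‖f z‖ₑ ^ 2 ∂squareMeasure ∧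
      ∫⁻ z in E, ‖f z‖ₑ ^ 2 ∂squareMeasure ≤ ENNReal.ofReal B * squareMeasure E := by
  obtain ⟨hA, hB, -, h⟩ := h
  set u : Lp ℂ 2 squareMeasure := indicatorConstLp 2 hE (measure_ne_top _ _) (1 : ℂ) with hu
  have hasum : HasSum (fun p => squareBasis.repr u p • squareBasis p) u :=
    squareBasis.hasSum_repr u
  have hn : HasSum (fun p => ‖squareBasis.repr u p‖ ^ 2) (‖u‖ ^ 2) := by
    have := lp.hasSum_norm (p := 2) (by simp) (squareBasis.repr u)
    simpa using this
  obtain ⟨s, hs, h1, h2⟩ := h _ hn.summable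
  rw [hn.tsum_eq] at h1 h2
  have hu2 : ENNReal.ofReal (‖u‖ ^ 2) = squareMeasure E := by
    rw [ENNReal.ofReal_pow (norm_nonneg _), ofReal_norm, enorm_Lp_sq,
      ← lintegral_indicator_one hE]
    refine lintegral_congr_ae ?_
    filter_upwards [indicatorConstLp_coeFn (p := 2) (hs := hE)
      (hμs := measure_ne_top squareMeasure E) (c := (1 : ℂ))] with z hz
    rw [hu, hz]
    by_cases hzE : z ∈ E <;> simp [Set.indicator, hzE]
  have hS : HasSum (fun p => squareBasis.repr u p •
      (memLp_squareChar_mul p (Lp.memLp f)).toLp _) (zakInvEquiv.symm s) := by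
    have := hs.mapL zakInvEquiv.symm.toContinuousLinearEquiv.toContinuousLinearMap
    simpa [gaborSystem_zakInvEquiv] using this
  have hfu : zakInvEquiv.symm s =ᵐ[squareMeasure] fun z => f z * u z := by
    refine ae_eq_mul_of_tendsto hasum hS fun t => ?_
    have e1 : ∀ᵐ z ∂squareMeasure, ∀ p, (squareBasis.repr u p • squareBasis p :
        Lp ℂ 2 squareMeasure) z = squareBasis.repr u p * squareChar p z := by
      refine ae_all_iff.2 fun p => ?_
      filter_upwards [Lp.coeFn_smul (squareBasis.repr u p) (squareBasis p),
        (memLp_squareChar p).coeFn_toLp] with z h1 h2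
      rw [h1, Pi.smul_apply, squareBasis_apply, h2, smul_eq_mul]
    have e2 : ∀ᵐ z ∂squareMeasure, ∀ p, (squareBasis.repr u p •
        (memLp_squareChar_mul p (Lp.memLp f)).toLp _ : Lp ℂ 2 squareMeasure) z
          = squareBasis.repr u p * (squareChar p z * f z) := by
      refine ae_all_iff.2 fun p => ?_
      filter_upwards [Lp.coeFn_smul (squareBasis.repr u p)
        ((memLp_squareChar_mul p (Lp.memLp f)).toLp _),
        (memLp_squareChar_mul p (Lp.memLp f)).coeFn_toLp] with z h1 h2
      rw [h1, Pi.smul_apply, h2, smul_eq_mul]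
    filter_upwards [e1, e2, Lp.coeFn_finsetSum t fun p => squareBasis.repr u p • squareBasis p,
      Lp.coeFn_finsetSum t fun p => squareBasis.repr u p •
        (memLp_squareChar_mul p (Lp.memLp f)).toLp _] with z h1 h2 h3 h4
    rw [h3, h4, Finset.sum_apply, Finset.sum_apply, Finset.mul_sum]
    refine Finset.sum_congr rfl fun p _ => ?_
    rw [h1, h2]
    ring
  have hs2 : ENNReal.ofReal (‖s‖ ^ 2) = ∫⁻ z in E, ‖f z‖ₑ ^ 2 ∂squareMeasure := by
    rw [← zakInvEquiv.symm.norm_map s, ENNReal.ofReal_pow (norm_nonneg _), ofReal_norm,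
      enorm_Lp_sq, ← lintegral_indicator hE]
    refine lintegral_congr_ae ?_
    filter_upwards [hfu, indicatorConstLp_coeFn (p := 2) (hs := hE)
      (hμs := measure_ne_top squareMeasure E) (c := (1 : ℂ))] with z hz1 hz2
    rw [hz1, hu, hz2]
    by_cases hzE : z ∈ E <;> simp [Set.indicator, hzE]
  rw [← hs2, ← hu2, ← ENNReal.ofReal_mul hA.le, ← ENNReal.ofReal_mul hB.le]
  exact ⟨ENNReal.ofReal_le_ofReal h1, ENNReal.ofReal_le_ofReal h2⟩

theorem ae_bounds_of_isRieszBasisWithBounds {f : Lp ℂ 2 squareMeasure} {A B : ℝ}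
    (h : IsRieszBasisWithBounds (gaborSystem (zakInvEquiv f)) A B) :
    ∀ᵐ z ∂squareMeasure, A ≤ ‖f z‖ ^ 2 ∧ ‖f z‖ ^ 2 ≤ B := by
  have hfm : Measurable (fun z => ‖f z‖ₑ ^ 2) := (Lp.stronglyMeasurable f).enorm.pow_const 2
  have h1 : ∀ᵐ z ∂squareMeasure, ENNReal.ofReal A ≤ ‖f z‖ₑ ^ 2 :=
    ae_le_of_forall_setLIntegral_le_of_sigmaFinite measurable_const fun E hE _ => by
      simpa using (setLIntegral_le_of_isRieszBasisWithBounds h hE).1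
  have h2 : ∀ᵐ z ∂squareMeasure, ‖f z‖ₑ ^ 2 ≤ ENNReal.ofReal B :=
    ae_le_of_forall_setLIntegral_le_of_sigmaFinite hfm fun E hE _ => by
      simpa using (setLIntegral_le_of_isRieszBasisWithBounds h hE).2
  filter_upwards [h1, h2] with z hz1 hz2
  rw [← ofReal_norm, ← ENNReal.ofReal_pow (norm_nonneg _)] at hz1 hz2
  exact ⟨(ENNReal.ofReal_le_ofReal_iff (by positivity)).1 hz1,
    (ENNReal.ofReal_le_ofReal_iff h.2.1.le).1 hz2⟩

/-- Multiplication by a unimodular `F` is unitary with adjoint multiplication by its conjugate, so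
orthonormality and completeness are inherited from the characters. -/
theorem isOrthonormalBasis_gaborSystem {F : ℝ × ℝ → ℂ} (hF : MemLp F 2 squareMeasure)
    (h1 : ∀ z, ‖F z‖ = 1) : IsOrthonormalBasis (gaborSystem (zakInvEquiv (hF.toLp F))) := by
  have hv (p : ℤ × ℤ) : gaborSystem (zakInvEquiv (hF.toLp F)) p
      = zakInvEquiv ((memLp_squareChar_mul p hF).toLp _) := by
    rw [gaborSystem_zakInvEquiv]
    congr 1
    refine (MemLp.toLp_eq_toLp_iff _ _).2 ?_
    filter_upwards [hF.coeFn_toLp] with z hz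
    rw [hz]
  have hmul {u : ℝ × ℝ → ℂ} (hu : MemLp u 2 squareMeasure) :
      MemLp (fun z => starRingEnd ℂ (F z) * u z) 2 squareMeasure := by
    refine hu.of_le ((Complex.continuous_conj.comp_aestronglyMeasurable hF.1).mul hu.1)
      (Filter.Eventually.of_forall fun z => ?_)
    simp [h1]
  have hFF (z : ℝ × ℝ) : starRingEnd ℂ (F z) * F z = 1 := by
    rw [Complex.conj_mul', h1]; simp
  have hin (p : ℤ × ℤ) (u : Lp ℂ 2 squareMeasure) :
      inner ℂ ((memLp_squareChar_mul p hF).toLp _) u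
        = inner ℂ (squareBasis p) ((hmul (Lp.memLp u)).toLp _) := by
    rw [L2.inner_def, L2.inner_def]
    refine integral_congr_ae ?_
    filter_upwards [(memLp_squareChar_mul p hF).coeFn_toLp, (hmul (Lp.memLp u)).coeFn_toLp,
      (memLp_squareChar p).coeFn_toLp] with z hz1 hz2 hz3
    rw [hz1, hz2, squareBasis_apply, hz3]
    simp only [RCLike.inner_apply, map_mul]
    ring
  constructor
  · rw [show gaborSystem (zakInvEquiv (hF.toLp F)) = fun p => zakInvEquiv
      ((memLp_squareChar_mul p hF).toLp _) from funext hv]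
    refine Orthonormal.comp_linearIsometryEquiv ?_ zakInvEquiv
    rw [orthonormal_iff_ite]
    intro p q
    rw [hin, ← orthonormal_iff_ite.1 squareBasis.orthonormal p q]
    congr 1
    rw [squareBasis_apply]
    refine (MemLp.toLp_eq_toLp_iff _ _).2 ?_
    filter_upwards [(memLp_squareChar_mul q hF).coeFn_toLp] with z hz
    rw [hz, mul_left_comm, hFF, mul_one]
  · rw [IsCompleteSystem, Submodule.topologicalClosure_eq_top_iff, Submodule.eq_bot_iff]
    intro h hh
    obtain ⟨u, rfl⟩ := zakInvEquiv.surjective h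
    have h0 (p : ℤ × ℤ) : inner ℂ (squareBasis p) ((hmul (Lp.memLp u)).toLp _) = 0 := by
      rw [← hin, ← zakInvEquiv.inner_map_map, ← hv]
      exact (Submodule.mem_orthogonal _ _).1 hh _ (Submodule.subset_span ⟨p, rfl⟩)
    have h2 : (hmul (Lp.memLp u)).toLp _ = 0 := by
      apply squareBasis.repr.injective
      ext p
      rw [squareBasis.repr_apply_apply, h0, map_zero]
      rfl
    have h3 : u = 0 := by
      refine (Lp.eq_zero_iff_ae_eq_zero).2 ?_
      filter_upwards [(hmul (Lp.memLp u)).coeFn_toLp, (Lp.eq_zero_iff_ae_eq_zero).1 h2]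
        with z hz1 hz2
      rw [hz1] at hz2
      have hz3 := h1 z
      have hFz : starRingEnd ℂ (F z) ≠ 0 := by
        intro h
        rw [← norm_eq_zero, RCLike.norm_conj, hz3] at h
        exact one_ne_zero h
      simpa [hFz] using hz2
    rw [h3, map_zero]

/-! ### Translations and Plancherel's theorem -/

/-- Translation by `s` on `L²(ℝ)`: `(timeTranslate s g)(t) = g(t + s)`. -/
noncomputable def timeTranslate (s : ℝ) : L2R →ₗᵢ[ℂ] L2R :=
  Lp.compMeasurePreservingₗᵢ ℂ (fun t => t + s) (measurePreserving_add_right volume s)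

theorem timeTranslate_coeFn (s : ℝ) (g : L2R) : timeTranslate s g =ᵐ[volume] fun t => g (t + s) :=
  Lp.coeFn_compMeasurePreserving g (measurePreserving_add_right volume s)

theorem fourier_comp_add_right (f : ℝ → ℂ) (s ξ : ℝ) :
    𝓕 (fun t => f (t + s)) ξ = expi (s * ξ) * 𝓕 f ξ := by
  have h (t : ℝ) : Real.fourierChar (-(t * ξ)) • f (t + s)
      = expi (s * ξ) * (Real.fourierChar (-((t + s) * ξ)) • f (t + s)) := by
    simp only [Circle.smul_def, smul_eq_mul, Real.fourierChar_apply, ← mul_assoc]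
    congr 1
    unfold expi
    rw [← Complex.exp_add]
    congr 1
    push_cast
    ring
  simp only [Real.fourier_real_eq, h]
  rw [integral_const_mul,
    integral_add_right_eq_self (fun t => Real.fourierChar (-(t * ξ)) • f t) s]

/-- The integral formula applies to Schwartz functions; both sides pass to `L²` limits of these. -/
theorem fourier_timeTranslate (s : ℝ) (g : L2R) :
    (𝓕 (timeTranslate s g) : L2R) =ᵐ[volume] fun ξ => expi (s * ξ) * (𝓕 g : L2R) ξ := by
  obtain ⟨φ, hφ, hlim⟩ := mem_closure_iff_seq_limit.1 ((SchwartzMap.denseRange_toLpCLM (E := ℝ)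
    (F := ℂ) (μ := volume) (p := 2) ENNReal.ofNat_ne_top) g)
  have hc : Continuous fun f : L2R => (𝓕 f : L2R) := (Lp.fourierTransformₗᵢ ℝ ℂ).continuous
  refine ae_eq_mul_of_tendsto (l := Filter.atTop) ((hc.tendsto g).comp hlim)
    (((hc.comp (timeTranslate s).continuous).tendsto g).comp hlim) fun n => ?_
  obtain ⟨ψ, hψ⟩ := hφ n
  simp only [SchwartzMap.toLpCLM_apply] at hψ
  have hs : timeTranslate s (φ n) = (ψ.compSubConstCLM ℂ (-s)).toLp 2 := by
    refine Lp.ext ?_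
    rw [← hψ]
    filter_upwards [timeTranslate_coeFn s (ψ.toLp 2), (ψ.compSubConstCLM ℂ (-s)).coeFn_toLp 2,
      (measurePreserving_add_right volume s).quasiMeasurePreserving.ae (ψ.coeFn_toLp 2 volume)]
      with t h1 h2 h3
    rw [h1, h2, h3, SchwartzMap.compSubConstCLM_apply, sub_neg_eq_add]
  simp only [Function.comp_apply]
  rw [hs, ← hψ, SchwartzMap.toLp_fourier_eq, SchwartzMap.toLp_fourier_eq]
  filter_upwards [(𝓕 ψ).coeFn_toLp 2, (𝓕 (ψ.compSubConstCLM ℂ (-s))).coeFn_toLp 2] with ξ h1 h2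
  rw [h1, h2, SchwartzMap.fourier_coe, SchwartzMap.fourier_coe, ← fourier_comp_add_right]
  refine congrArg (fun f : ℝ → ℂ => 𝓕 f ξ) ?_
  funext t
  rw [SchwartzMap.compSubConstCLM_apply, sub_neg_eq_add]

/-- Plancherel's theorem for absolutely convergent combinations of translates. -/
theorem lintegral_tsum_translate {g : ℝ → ℂ} (hg : MemLp g 2 volume) {K : ℝ}
    (hK : ∀ t, ‖g t‖ ≤ K) {c : ℤ → ℂ} (hc : Summable fun j => ‖c j‖) (h : ℝ) :
    ∫⁻ t, ‖∑' j, c j * g (t + j * h)‖ₑ ^ 2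
      = ∫⁻ ξ, ‖∑' j, c j * expi (j * h * ξ)‖ₑ ^ 2 * ‖(𝓕 (hg.toLp g) : L2R) ξ‖ₑ ^ 2 := by
  have hsum : Summable fun j : ℤ => c j • timeTranslate (j * h) (hg.toLp g) := by
    refine Summable.of_norm ?_
    simpa [norm_smul] using hc.mul_right ‖hg.toLp g‖
  obtain ⟨s, hs⟩ := hsum
  have h1 : s =ᵐ[volume] fun t => ∑' j, c j * g (t + j * h) := by
    refine ae_eq_of_hasSum_of_hasSum (f := fun j t => c j * g (t + j * h)) hs (fun j => ?_) ?_
    · filter_upwards [Lp.coeFn_smul (c j) (timeTranslate (j * h) (hg.toLp g)),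
        timeTranslate_coeFn (j * h) (hg.toLp g),
        (measurePreserving_add_right volume (j * h)).quasiMeasurePreserving.ae hg.coeFn_toLp]
        with t h1 h2 h3
      rw [h1, Pi.smul_apply, h2, h3, smul_eq_mul]
    · refine Filter.Eventually.of_forall fun t => Summable.hasSum ?_
      refine Summable.of_norm_bounded (hc.mul_right K) fun j => ?_
      rw [norm_mul]
      exact mul_le_mul_of_nonneg_left (hK _) (norm_nonneg _)
  have hs' : HasSum (fun j : ℤ => c j • (𝓕 (timeTranslate (j * h) (hg.toLp g)) : L2R)) (𝓕 s) := by
    have := hs.mapL (Lp.fourierTransformₗᵢ ℝ ℂ).toContinuousLinearEquiv.toContinuousLinearMap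
    simp only [map_smul] at this
    exact this
  have h2 : (𝓕 s : L2R) =ᵐ[volume]
      fun ξ => (∑' j, c j * expi (j * h * ξ)) * (𝓕 (hg.toLp g) : L2R) ξ := by
    refine ae_eq_of_hasSum_of_hasSum
      (f := fun j ξ => (c j * expi (j * h * ξ)) * (𝓕 (hg.toLp g) : L2R) ξ) hs' (fun j => ?_) ?_
    · filter_upwards [Lp.coeFn_smul (c j) (𝓕 (timeTranslate (j * h) (hg.toLp g)) : L2R),
        fourier_timeTranslate (j * h) (hg.toLp g)] with ξ h1 h2
      rw [h1, Pi.smul_apply, h2, smul_eq_mul]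
      ring
    · refine Filter.Eventually.of_forall fun ξ => (Summable.hasSum ?_).mul_right _
      exact Summable.of_norm (by simpa using hc)
  have h3 : ‖(𝓕 s : L2R)‖ₑ ^ 2 = ‖s‖ₑ ^ 2 := by
    rw [← ofReal_norm, ← ofReal_norm, Lp.norm_fourier_eq]
  rw [enorm_Lp_sq, enorm_Lp_sq] at h3
  calc ∫⁻ t, ‖∑' j, c j * g (t + j * h)‖ₑ ^ 2 = ∫⁻ t, ‖s t‖ₑ ^ 2 :=
        lintegral_congr_ae (by filter_upwards [h1] with t ht; rw [ht])
    _ = ∫⁻ ξ, ‖(𝓕 s : L2R) ξ‖ₑ ^ 2 := h3.symm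
    _ = _ := lintegral_congr_ae (by filter_upwards [h2] with t ht; rw [ht, enorm_mul, mul_pow])

/-! ### Fourier series that vanish near the origin -/

theorem norm_expi_sub_one_le (t : ℝ) : ‖expi t - 1‖ ≤ 2 * Real.pi * |t| := by
  rw [expi_eq, mul_comm]
  refine (Real.norm_exp_I_mul_ofReal_sub_one_le).trans (le_of_eq ?_)
  rw [Real.norm_eq_abs, abs_mul, abs_of_pos Real.two_pi_pos]

theorem hasDerivAt_expi (t : ℝ) : HasDerivAt expi (2 * Real.pi * Complex.I * expi t) t := by
  have h : HasDerivAt (fun t : ℝ => 2 * (Real.pi : ℂ) * Complex.I * (t : ℂ))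
      (2 * (Real.pi : ℂ) * Complex.I * 1) t := (Complex.ofRealCLM.hasDerivAt).const_mul _
  have := h.cexp
  unfold expi
  convert this using 1
  ring

/-- A smooth cutoff with a bounded derivative. -/
theorem exists_smooth_cutoff : ∃ χ χ' : ℝ → ℝ, ∃ C : ℝ, 0 ≤ C ∧ (∀ x, HasDerivAt χ (χ' x) x) ∧
    Continuous χ' ∧ (∀ x, |x| ≤ 1 → χ x = 1) ∧ (∀ x, 2 < |x| → χ x = 0 ∧ χ' x = 0) ∧
    (∀ x, |χ x| ≤ 1) ∧ ∀ x, |χ' x| ≤ C := by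
  let f : ContDiffBump (0 : ℝ) := ⟨1, 2, one_pos, one_lt_two⟩
  have hf : ContDiff ℝ 1 f := f.contDiff
  have hc : Continuous (deriv f) := hf.continuous_deriv le_rfl
  obtain ⟨C, hC⟩ := f.hasCompactSupport.deriv.exists_bound_of_continuous hc
  have hz (x : ℝ) (hx : 2 ≤ |x|) : f x = 0 := f.zero_of_le_dist (by simpa using hx)
  refine ⟨f, deriv f, C, (norm_nonneg _).trans (hC 0),
    fun x => (hf.differentiable one_ne_zero x).hasDerivAt, hc, fun x hx => ?_, fun x hx => ⟨hz x hx.le, ?_⟩,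
    fun x => ?_, hC⟩
  · exact f.one_of_mem_closedBall (by simpa using hx)
  · have : (f : ℝ → ℝ) =ᶠ[nhds x] fun _ => 0 := by
      filter_upwards [(isOpen_lt continuous_const continuous_abs).mem_nhds hx] with y hy
      exact hz y (le_of_lt hy)
    rw [this.deriv_eq, deriv_const]
  · rw [abs_of_nonneg f.nonneg]
    exact f.le_one

theorem integral_norm_sq_le_of_support {w : ℝ → ℂ} {δ D : ℝ} (hδ : 0 ≤ δ) (hw : Continuous w)
    (hD : ∀ x, ‖w x‖ ≤ D) (h0 : ∀ x, δ < |x| → w x = 0) {a b : ℝ} (hab : a ≤ b) :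
    ∫ x in a..b, ‖w x‖ ^ 2 ≤ D ^ 2 * (2 * δ) := by
  rw [intervalIntegral.integral_of_le hab]
  have hi : Integrable ((Set.Icc (-δ) δ).indicator fun _ : ℝ => D ^ 2) volume :=
    (integrable_indicator_iff measurableSet_Icc).2 (integrableOn_const (by simp))
  calc ∫ x in Set.Ioc a b, ‖w x‖ ^ 2
      ≤ ∫ x in Set.Ioc a b, (Set.Icc (-δ) δ).indicator (fun _ : ℝ => D ^ 2) x := by
        refine integral_mono ((hw.norm.pow 2).integrableOn_Ioc) hi.integrableOn fun x => ?_
        by_cases hx : |x| ≤ δ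
        · have : x ∈ Set.Icc (-δ) δ := abs_le.1 hx
          simp only [Set.indicator_of_mem this]
          exact pow_le_pow_left₀ (norm_nonneg _) (hD x) 2
        · simp only [h0 x (not_le.1 hx), norm_zero]
          rw [zero_pow two_ne_zero]
          exact Set.indicator_nonneg (fun _ _ => sq_nonneg D) x
    _ ≤ ∫ x, (Set.Icc (-δ) δ).indicator (fun _ : ℝ => D ^ 2) x :=
        setIntegral_le_integral hi
          (Filter.Eventually.of_forall (Set.indicator_nonneg fun _ _ => sq_nonneg D))
    _ = D ^ 2 * (2 * δ) := by
        rw [integral_indicator measurableSet_Icc, setIntegral_const]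
        simp only [Real.volume_real_Icc_of_le (by linarith : -δ ≤ δ), smul_eq_mul]
        ring

/-- Near the origin `e^{2πiθ} - 1` agrees with an absolutely convergent Fourier series of small
Wiener norm. -/
theorem exists_small_fourierSeries_eq_expi_sub_one {ε : ℝ} (hε : 0 < ε) :
    ∃ δ : ℝ, 0 < δ ∧ ∃ d : ℤ → ℂ, Summable (fun j => ‖d j‖) ∧ ∑' j, ‖d j‖ ≤ ε ∧
      ∀ θ : ℝ, |θ| ≤ δ → HasSum (fun j : ℤ => d j * expi (j * θ)) (expi θ - 1) := by
  obtain ⟨χ, χ', C, hC0, hχ, hχc, hχ1, hχ0, hχb, hχ'b⟩ := exists_smooth_cutoff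
  have hχcont : Continuous χ := continuous_iff_continuousAt.2 fun x => (hχ x).continuousAt
  have hpi := Real.pi_pos
  -- A bound for the derivative of the cut-off function that does not depend on `δ`: the factor
  -- `1/δ` from the cutoff is cancelled by `|e^{2πiθ} - 1| ≤ 4πδ` on its support.
  set D : ℝ := 2 * Real.pi + 4 * Real.pi * C with hD
  have hD0 : 0 ≤ D := by positivity
  have hZ : Summable fun n : ℤ => 1 / (n : ℝ) ^ 2 := Real.summable_one_div_int_pow.2 one_lt_two
  set Z : ℝ := ∑' n : ℤ, 1 / (n : ℝ) ^ 2 with hZdef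
  have hZ0 : 0 ≤ Z := tsum_nonneg fun n => by positivity
  obtain ⟨η, hη0, hη8, hηε⟩ : ∃ η : ℝ, 0 < η ∧ η ≤ 1 / 4 ∧
      η * (4 * Real.pi + Z + 4 * D ^ 2) ≤ ε := by
    have hK : 0 < 4 * Real.pi + Z + 4 * D ^ 2 := by positivity
    refine ⟨min (1 / 4) (ε / (4 * Real.pi + Z + 4 * D ^ 2)), by positivity, min_le_left _ _, ?_⟩
    exact (le_div_iff₀ hK).1 (min_le_right _ _)
  -- The width `η²` balances the terms `ηZ` and `4D²δ/η` of the final estimate, so that the Wiener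
  -- norm is `O(η)`.
  set δ : ℝ := η ^ 2 with hδ
  have hδ0 : 0 < δ := by positivity
  have hδ8 : δ ≤ 1 / 16 := by nlinarith
  set w : ℝ → ℂ := fun θ => (expi θ - 1) * (χ (θ / δ) : ℂ) with hw
  set w' : ℝ → ℂ := fun θ => 2 * Real.pi * Complex.I * expi θ * (χ (θ / δ) : ℂ)
    + (expi θ - 1) * ((χ' (θ / δ) * (1 / δ) : ℝ) : ℂ) with hw'
  have hder (θ : ℝ) : HasDerivAt w (w' θ) θ := by
    have h1 : HasDerivAt (fun θ : ℝ => χ (θ / δ)) (χ' (θ / δ) * (1 / δ)) θ :=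
      (hχ (θ / δ)).comp θ ((hasDerivAt_id θ).div_const δ)
    exact ((hasDerivAt_expi θ).sub_const 1).mul h1.ofReal_comp
  have hwc : Continuous w := continuous_iff_continuousAt.2 fun x => (hder x).continuousAt
  have hw'c : Continuous w' := by
    refine ((continuous_const.mul continuous_expi).mul (Complex.continuous_ofReal.comp
      (hχcont.comp (continuous_id.div_const δ)))).add ((continuous_expi.sub continuous_const).mul
      (Complex.continuous_ofReal.comp ((hχc.comp (continuous_id.div_const δ)).mul
        continuous_const)))
  have hbig (θ : ℝ) (hθ : 2 * δ < |θ|) : 2 < |θ / δ| := by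
    rw [abs_div, abs_of_pos hδ0, lt_div_iff₀ hδ0]; exact hθ
  have hw0 (θ : ℝ) (hθ : 2 * δ < |θ|) : w θ = 0 := by
    simp [hw, (hχ0 _ (hbig θ hθ)).1]
  have hw'0 (θ : ℝ) (hθ : 2 * δ < |θ|) : w' θ = 0 := by
    simp [hw', (hχ0 _ (hbig θ hθ)).1, (hχ0 _ (hbig θ hθ)).2]
  have hsmall (θ : ℝ) (hθ : |θ| ≤ 2 * δ) : ‖expi θ - 1‖ ≤ 4 * Real.pi * δ :=
    (norm_expi_sub_one_le θ).trans (by nlinarith)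
  have hwb (θ : ℝ) : ‖w θ‖ ≤ 4 * Real.pi * δ := by
    rcases le_or_gt (|θ|) (2 * δ) with hθ | hθ
    · simp only [hw, norm_mul, Complex.norm_real, Real.norm_eq_abs]
      calc ‖expi θ - 1‖ * |χ (θ / δ)| ≤ (4 * Real.pi * δ) * 1 :=
            mul_le_mul (hsmall θ hθ) (hχb _) (abs_nonneg _) (by positivity)
        _ = _ := mul_one _
    · rw [hw0 θ hθ, norm_zero]; positivity
  have hw'b (θ : ℝ) : ‖w' θ‖ ≤ D := by
    rcases le_or_gt (|θ|) (2 * δ) with hθ | hθ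
    · refine (norm_add_le _ _).trans (add_le_add ?_ ?_)
      · simp only [norm_mul, Complex.norm_real, Real.norm_eq_abs, norm_expi, Complex.norm_I,
          Complex.norm_ofNat, mul_one, abs_of_pos hpi]
        exact mul_le_of_le_one_right (by positivity) (hχb _)
      · rw [norm_mul, Complex.norm_real, Real.norm_eq_abs, abs_mul,
          abs_of_pos (one_div_pos.2 hδ0)]
        calc ‖expi θ - 1‖ * (|χ' (θ / δ)| * (1 / δ))
            ≤ (4 * Real.pi * δ) * (C * (1 / δ)) := by
              refine mul_le_mul (hsmall θ hθ) ?_ (by positivity) (by positivity)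
              exact mul_le_mul_of_nonneg_right (hχ'b _) (by positivity)
          _ = 4 * Real.pi * C := by field_simp
    · rw [hw'0 θ hθ, norm_zero]; exact hD0
  -- The period is centred at the origin so that the support, contained in `|θ| ≤ 2δ ≤ 1/8`, avoids
  -- the endpoints.
  have hab : (-1 / 2 : ℝ) < -1 / 2 + 1 := by norm_num
  have hend : w (-1 / 2) = 0 ∧ w (-1 / 2 + 1) = 0 := by
    constructor <;> refine hw0 _ ?_ <;> rw [lt_abs]
    · right; linarith
    · left; linarith
  set a : ℤ → ℂ := fourierCoeffOn hab w with ha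
  set a' : ℤ → ℂ := fourierCoeffOn hab w' with ha'
  have hrel (n : ℤ) (hn : n ≠ 0) : ‖a n‖ ≤ ‖a' n‖ * (1 / |(n : ℝ)|) := by
    have h := fourierCoeffOn_of_hasDerivAt hab hn (fun x _ => hder x)
      (hw'c.intervalIntegrable _ _)
    rw [← ha, ← ha', hend.1, hend.2] at h
    rw [h]
    have hn' : 0 < |(n : ℝ)| := abs_pos.2 (Int.cast_ne_zero.2 hn)
    simp only [sub_self, mul_zero, zero_sub]
    rw [norm_mul, norm_neg, norm_mul, norm_div]
    simp only [norm_mul, norm_neg, Complex.norm_I, Complex.norm_real, Complex.norm_intCast,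
      norm_one, mul_one, Complex.norm_ofNat, Real.norm_eq_abs, abs_of_pos hpi]
    have e : ‖((-1 / 2 + 1 : ℝ) : ℂ) - ((-1 / 2 : ℝ) : ℂ)‖ = 1 := by
      rw [← Complex.ofReal_sub, Complex.norm_real]; norm_num
    rw [e, one_mul, mul_comm]
    refine mul_le_mul_of_nonneg_left ?_ (norm_nonneg _)
    refine one_div_le_one_div_of_le hn' ?_
    nlinarith [Real.pi_gt_three]
  have hpars := hasSum_sq_fourierCoeffOn (f := w') hab
    ((memLp_top_of_bound hw'c.aestronglyMeasurable D (Filter.Eventually.of_forall hw'b)).mono_exponent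
      le_top)
  have hparsle : ∑' n, ‖a' n‖ ^ 2 ≤ D ^ 2 * (4 * δ) := by
    rw [hpars.tsum_eq]
    have := integral_norm_sq_le_of_support (by positivity) hw'c hw'b hw'0 hab.le
    norm_num at this ⊢
    linarith
  have ha0 : ‖a 0‖ ≤ 4 * Real.pi * δ := by
    rw [ha, fourierCoeffOn_eq_integral, norm_smul]
    have := intervalIntegral.norm_integral_le_of_norm_le_const (a := (-1 / 2 : ℝ)) (b := -1 / 2 + 1)
      (f := fun x => fourier (-0) (x : AddCircle ((-1 / 2 + 1 : ℝ) - -1 / 2)) • w x)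
      (C := 4 * Real.pi * δ) (fun x _ => by simpa using hwb x)
    norm_num at this ⊢
    exact this
  -- Integration by parts gives `|aₙ| ≤ |a'ₙ|/|n|`, and the weighted inequality of means splits the
  -- product into summable squares. Parseval for the derivative supplies a factor `δ`. At `n = 0`
  -- the quotient `1/n²` is zero by convention and `|a₀|` is kept separately.
  have hbound (n : ℤ) : ‖a n‖ ≤ (if n = 0 then ‖a 0‖ else 0) + η * (1 / (n : ℝ) ^ 2)
      + η⁻¹ * ‖a' n‖ ^ 2 := by
    by_cases hn : n = 0
    · subst hn
      simp only [if_true]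
      have : 0 ≤ η⁻¹ * ‖a' 0‖ ^ 2 := by positivity
      have : 0 ≤ η * (1 / ((0 : ℤ) : ℝ) ^ 2) := by positivity
      linarith
    · rw [if_neg hn, zero_add]
      refine (hrel n hn).trans ?_
      rw [← sq_abs (n : ℝ)]
      set y := 1 / |(n : ℝ)| with hy
      have e : 1 / |(n : ℝ)| ^ 2 = y ^ 2 := by rw [hy]; ring
      rw [e]
      have h1 : 0 ≤ η⁻¹ * (η * y - ‖a' n‖) ^ 2 := by positivity
      have h2 : η⁻¹ * (η * y - ‖a' n‖) ^ 2 = η * y ^ 2 + η⁻¹ * ‖a' n‖ ^ 2 - 2 * (‖a' n‖ * y) := by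
        field_simp; ring
      have h3 : 0 ≤ ‖a' n‖ * y := by positivity
      linarith
  have hsB : HasSum (fun n : ℤ => (if n = 0 then ‖a 0‖ else 0) + η * (1 / (n : ℝ) ^ 2)
      + η⁻¹ * ‖a' n‖ ^ 2) (‖a 0‖ + η * Z + η⁻¹ * ∑' n, ‖a' n‖ ^ 2) :=
    ((hasSum_ite_eq 0 ‖a 0‖).add (hZ.hasSum.mul_left η)).add
      (hpars.summable.hasSum.mul_left η⁻¹)
  have hsa : Summable fun n => ‖a n‖ := Summable.of_nonneg_of_le (fun _ => norm_nonneg _) hbound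
    hsB.summable
  refine ⟨δ, hδ0, a, hsa, ?_, fun θ hθ => ?_⟩
  · calc ∑' n, ‖a n‖ ≤ ‖a 0‖ + η * Z + η⁻¹ * ∑' n, ‖a' n‖ ^ 2 := by
          rw [← hsB.tsum_eq]; exact hsa.tsum_le_tsum hbound hsB.summable
      _ ≤ 4 * Real.pi * δ + η * Z + η⁻¹ * (D ^ 2 * (4 * δ)) := by gcongr
      _ ≤ η * (4 * Real.pi + Z + 4 * D ^ 2) := by
          have e : η⁻¹ * (D ^ 2 * (4 * δ)) = 4 * D ^ 2 * η := by rw [hδ]; field_simp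
          rw [e]
          have : δ ≤ η := by rw [hδ]; nlinarith
          nlinarith
      _ ≤ ε := hηε
  · let f : C(AddCircle (1 : ℝ), ℂ) := ⟨AddCircle.liftIco 1 (-1 / 2) w,
      AddCircle.liftIco_continuous (by rw [hend.1, hend.2]) hwc.continuousOn⟩
    have hcoef : fourierCoeff f = a := by
      funext n
      exact fourierCoeff_liftIco_eq w n
    have hθ' : θ ∈ Set.Ico (-1 / 2 : ℝ) (-1 / 2 + 1) := by
      have := abs_le.1 hθ
      constructor <;> linarith [this.1, this.2]
    have h := has_pointwise_sum_fourier_series_of_summable (f := f)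
      (by rw [hcoef]; exact hsa.of_norm) (θ : AddCircle (1 : ℝ))
    rw [hcoef] at h
    have hfw : f (θ : AddCircle (1 : ℝ)) = expi θ - 1 := by
      have h1 : f (θ : AddCircle (1 : ℝ)) = w θ :=
        AddCircle.liftIco_coe_apply (f := w) hθ'
      rw [h1, hw]
      have : |θ / δ| ≤ 1 := by rw [abs_div, abs_of_pos hδ0, div_le_one hδ0]; exact hθ
      simp [hχ1 _ this]
    rw [hfw] at h
    simpa only [fourier_coe_eq_expi, smul_eq_mul] using h

/-- An absolutely summable sequence that resembles a difference quotient and whose Fourier series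
vanishes near the origin. -/
theorem exists_summable_near_difference {ε : ℝ} (hε : 0 < ε) (hε1 : ε ≤ 1) :
    ∃ δ : ℝ, 0 < δ ∧ ∃ c : ℤ → ℂ, Summable (fun j => ‖c j‖) ∧ ∑' j, ‖c j‖ ≤ 3 ∧
      (∀ θ : ℝ, |θ| ≤ δ → ∑' j : ℤ, c j * expi (j * θ) = 0) ∧
      ∀ (x : ℤ → ℂ) (b : ℝ), (∀ j, ‖x j‖ ≤ b) → ‖x 1 - x 0 - ∑' j, c j * x j‖ ≤ ε * b := by
  obtain ⟨δ, hδ, d, hd, hdε, hdθ⟩ := exists_small_fourierSeries_eq_expi_sub_one hε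
  have hsing (k : ℤ) (x : ℤ → ℂ) : HasSum (fun j => (if j = k then 1 else 0) * x j) (x k) := by
    have := hasSum_ite_eq k (x k)
    refine this.congr_fun fun j => ?_
    by_cases h : j = k <;> simp [h]
  have hn (k : ℤ) : HasSum (fun j : ℤ => ‖(if j = k then 1 else 0 : ℂ)‖) 1 := by
    refine (hasSum_ite_eq k (1 : ℝ)).congr_fun fun j => ?_
    by_cases h : j = k <;> simp [h]
  have hdx (x : ℤ → ℂ) (b : ℝ) (hx : ∀ j, ‖x j‖ ≤ b) (j : ℤ) : ‖d j * x j‖ ≤ ‖d j‖ * b := by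
    rw [norm_mul]
    exact mul_le_mul_of_nonneg_left (hx j) (norm_nonneg _)
  have hds (x : ℤ → ℂ) (b : ℝ) (hx : ∀ j, ‖x j‖ ≤ b) : Summable fun j => d j * x j :=
    Summable.of_norm_bounded (hd.mul_right b) (hdx x b hx)
  -- The difference minus the small series: the Fourier series of `c` is zero wherever that of `d`
  -- equals `e^{2πiθ} - 1`, and its `ℓ¹` norm is at most `2 + ε ≤ 3`.
  set c : ℤ → ℂ := fun j => (if j = 1 then 1 else 0) - (if j = 0 then 1 else 0) - d j with hc
  have hcx (x : ℤ → ℂ) (b : ℝ) (hx : ∀ j, ‖x j‖ ≤ b) :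
      HasSum (fun j => c j * x j) (x 1 - x 0 - ∑' j, d j * x j) := by
    refine (((hsing 1 x).sub (hsing 0 x)).sub (hds x b hx).hasSum).congr_fun fun j => ?_
    simp only [hc]; ring
  have hcn (j : ℤ) : ‖c j‖ ≤ ‖(if j = 1 then 1 else 0 : ℂ)‖ + ‖(if j = 0 then 1 else 0 : ℂ)‖
      + ‖d j‖ := (norm_sub_le _ _).trans (add_le_add_left (norm_sub_le _ _) _)
  have hB := ((hn 1).add (hn 0)).add hd.hasSum
  have hcs : Summable fun j => ‖c j‖ :=
    Summable.of_nonneg_of_le (fun _ => norm_nonneg _) hcn hB.summable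
  refine ⟨δ, hδ, c, hcs, ?_, fun θ hθ => ?_, fun x b hx => ?_⟩
  · have := hcs.tsum_le_tsum hcn hB.summable
    rw [hB.tsum_eq] at this
    linarith
  · rw [(hcx (fun j => expi (j * θ)) 1 fun j => (norm_expi _).le).tsum_eq, (hdθ θ hθ).tsum_eq]
    simp
  · rw [(hcx x b hx).tsum_eq, sub_sub_cancel]
    have hdn : Summable fun j => ‖d j * x j‖ :=
      Summable.of_nonneg_of_le (fun _ => norm_nonneg _) (hdx x b hx) (hd.mul_right b)
    have hb : 0 ≤ b := (norm_nonneg _).trans (hx 0)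
    calc ‖∑' j, d j * x j‖ ≤ ∑' j, ‖d j * x j‖ := norm_tsum_le_tsum_norm hdn
      _ ≤ ∑' j, ‖d j‖ * b := hdn.tsum_le_tsum (hdx x b hx) (hd.mul_right b)
      _ = (∑' j, ‖d j‖) * b := tsum_mul_right
      _ ≤ ε * b := mul_le_mul_of_nonneg_right hdε hb

/-! ### Winding on a grid and the measure of large steps -/

/-- The disc of radius `3/4` about `1` lies in the sector of half-angle `π/3`, since `3/4 <
sin(π/3)`. -/
theorem abs_arg_lt_pi_div_three {r : ℂ} (hr : ‖r - 1‖ < 3 / 4) : |Complex.arg r| < Real.pi / 3 := by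
  have hsq : ‖r - 1‖ ^ 2 < (3 / 4) ^ 2 := pow_lt_pow_left₀ hr (norm_nonneg _) two_ne_zero
  have h1 : (r.re - 1) ^ 2 + r.im ^ 2 < (3 / 4) ^ 2 := by
    rw [← Complex.normSq_eq_norm_sq, Complex.normSq_apply] at hsq
    simp only [Complex.sub_re, Complex.one_re, Complex.sub_im, Complex.one_im, sub_zero] at hsq
    nlinarith
  have hre : 0 < r.re := by nlinarith [sq_nonneg r.im]
  have hr0 : r ≠ 0 := by rintro rfl; simp at hre
  have hpos : 0 < ‖r‖ := norm_pos_iff.2 hr0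
  have h2 : ‖r‖ < 2 * r.re := by
    refine lt_of_pow_lt_pow_left₀ 2 (by positivity) ?_
    rw [← Complex.normSq_eq_norm_sq, Complex.normSq_apply]
    nlinarith [sq_nonneg (r.re - 1 / 4)]
  by_contra! h
  have h3 := Real.cos_le_cos_of_nonneg_of_le_pi (by positivity) (Complex.abs_arg_le_pi r) h
  rw [Real.cos_abs, Complex.cos_arg hr0, Real.cos_pi_div_three, div_le_iff₀ hpos] at h3
  linarith

theorem arg_coe_expi (t : ℝ) : ((Complex.arg (expi t) : ℝ) : Real.Angle) = ((2 * Real.pi * t : ℝ) : Real.Angle) := by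
  rw [expi_eq, Complex.arg_exp_mul_I, Real.Angle.coe_toIocMod]

/-- A nonvanishing quasi-periodic function on a grid cannot vary slowly everywhere. -/
theorem exists_large_variation {N M : ℕ} (hN : 0 < N) (hM : 3 ≤ M) {f : ℕ → ℕ → ℂ} {y : ℝ}
    (hf : ∀ i j, f i j ≠ 0) (hper : ∀ i, f i M = f i 0)
    (hquasi : ∀ j, f N j = expi (y + j / M) * f 0 j) :
    ∃ i < N, ∃ j < M, 3 / 4 * ‖f i j‖ ≤ ‖f (i + 1) j - f i j‖ ∨
      3 / 4 * ‖f i j‖ ≤ ‖f i (j + 1) - f i j‖ := by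
  by_contra! hcon
  have hM0 : (0 : ℝ) < M := by exact_mod_cast (by omega : 0 < M)
  have hpi := Real.pi_pos
  have hclose {z w : ℂ} (hz : z ≠ 0) (h : ‖w - z‖ < 3 / 4 * ‖z‖) :
      |Complex.arg (w / z)| < Real.pi / 3 := by
    refine abs_arg_lt_pi_div_three ?_
    rw [div_sub_one hz, norm_div, div_lt_iff₀ (norm_pos_iff.2 hz)]
    exact h
  set α : ℕ → ℕ → ℝ := fun i j => Complex.arg (f (i + 1) j / f i j) with hα
  set β : ℕ → ℕ → ℝ := fun i j => Complex.arg (f i (j + 1) / f i j) with hβ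
  -- On the last row the increment is lifted through quasi-periodicity from the first row, not by
  -- the principal argument; this is where the winding enters.
  set γ : ℕ → ℕ → ℝ := fun i j => if i = N then β 0 j + 2 * Real.pi / M else β i j with hγ
  have hαper (i : ℕ) : α i M = α i 0 := by simp only [hα, hper]
  have hαb (i j : ℕ) (hi : i < N) (hj : j ≤ M) : |α i j| < Real.pi / 3 := by
    rcases hj.lt_or_eq with h | rfl
    · exact hclose (hf i j) (hcon i hi j h).1
    · rw [hαper]
      exact hclose (hf i 0) (hcon i hi 0 (by omega)).1
  have hβb (i j : ℕ) (hi : i < N) (hj : j < M) : |β i j| < Real.pi / 3 :=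
    hclose (hf i j) (hcon i hi j hj).2
  have hγb (i j : ℕ) (hi : i < N) (hj : j < M) : |γ (i + 1) j| < Real.pi := by
    simp only [hγ]
    split_ifs with h
    · have h1 := abs_lt.1 (hβb 0 j hN hj)
      have h2 : 0 < 2 * Real.pi / M := by positivity
      have h3 : 2 * Real.pi / M ≤ 2 * Real.pi / 3 := by
        have : (3 : ℝ) ≤ M := by exact_mod_cast hM
        gcongr
      rw [abs_lt]
      constructor <;> linarith [h1.1, h1.2]
    · have := hβb (i + 1) j (by omega) hj
      linarith
  have hγangle (i j : ℕ) : ((γ i j : ℝ) : Real.Angle) = (β i j : ℝ) := by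
    simp only [hγ]
    split_ifs with h
    · subst h
      have e : f i (j + 1) / f i j = f 0 (j + 1) / f 0 j * expi (1 / M) := by
        rw [hquasi, hquasi]
        have : expi (y + ((j + 1 : ℕ) : ℝ) / M) = expi (y + j / M) * expi (1 / M) := by
          rw [← expi_add]; congr 1; push_cast; ring
        rw [this]
        have h1 := hf 0 j
        have h2 := expi_ne_zero (y + j / M)
        rw [div_mul_eq_mul_div, div_eq_div_iff (mul_ne_zero h2 h1) h1]
        ring
      simp only [hβ]
      rw [e, Complex.arg_mul_coe_angle (div_ne_zero (hf _ _) (hf _ _)) (expi_ne_zero _),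
        arg_coe_expi, Real.Angle.coe_add]
      congr 2
      ring
    · rfl
  -- Around a plaquette the increments add up to a multiple of `2π`. Three are below `π/3` and the
  -- fourth below `π` (as `M ≥ 3`), so the multiple is zero.
  have hplaq (i j : ℕ) (hi : i < N) (hj : j < M) :
      γ (i + 1) j - γ i j = α i (j + 1) - α i j := by
    have h1 : ((α i j + γ (i + 1) j : ℝ) : Real.Angle) = ((γ i j + α i (j + 1) : ℝ) : Real.Angle) := by
      rw [Real.Angle.coe_add, Real.Angle.coe_add, hγangle, hγangle]
      simp only [hα, hβ]
      rw [← Complex.arg_mul_coe_angle (div_ne_zero (hf _ _) (hf _ _)) (div_ne_zero (hf _ _) (hf _ _)),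
        ← Complex.arg_mul_coe_angle (div_ne_zero (hf _ _) (hf _ _)) (div_ne_zero (hf _ _) (hf _ _))]
      congr 2
      have h1 := hf i j
      have h2 := hf (i + 1) j
      have h3 := hf i (j + 1)
      field_simp
    obtain ⟨k, hk⟩ := Real.Angle.angle_eq_iff_two_pi_dvd_sub.1 h1
    have b1 := abs_lt.1 (hαb i j hi hj.le)
    have b2 := abs_lt.1 (hαb i (j + 1) hi hj)
    have b3 := abs_lt.1 (hγb i j hi hj)
    have b4 : |γ i j| < Real.pi / 3 := by
      simp only [hγ]; rw [if_neg (by omega)]; exact hβb i j hi hj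
    have b5 := abs_lt.1 b4
    have hk0 : k = 0 := by
      have h1 : (k : ℝ) < 1 := by
        by_contra! h
        nlinarith [b1.1, b1.2, b2.1, b2.2, b3.1, b3.2, b5.1, b5.2]
      have h2 : (-1 : ℝ) < k := by
        by_contra! h
        nlinarith [b1.1, b1.2, b2.1, b2.2, b3.1, b3.2, b5.1, b5.2]
      have h1' : k < 1 := by exact_mod_cast h1
      have h2' : -1 < k := by exact_mod_cast h2
      omega
    rw [hk0, Int.cast_zero, mul_zero] at hk
    linarith
  -- Summed over all plaquettes, the `γ` differences telescope to the total winding `2π`, whereas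
  -- the `α` differences telescope to zero by periodicity.
  have hS1 : ∑ j ∈ Finset.range M, ∑ i ∈ Finset.range N, (γ (i + 1) j - γ i j) = 2 * Real.pi := by
    have (j : ℕ) : ∑ i ∈ Finset.range N, (γ (i + 1) j - γ i j) = 2 * Real.pi / M := by
      rw [Finset.sum_range_sub (fun i => γ i j)]
      simp only [hγ, if_true]
      rw [if_neg (by omega)]
      ring
    simp only [this, Finset.sum_const, Finset.card_range, nsmul_eq_mul]
    field_simp
  have hS2 : ∑ j ∈ Finset.range M, ∑ i ∈ Finset.range N, (α i (j + 1) - α i j) = 0 := by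
    rw [Finset.sum_comm]
    refine Finset.sum_eq_zero fun i _ => ?_
    rw [Finset.sum_range_sub (fun j => α i j), hαper, sub_self]
  have : (2 * Real.pi : ℝ) = 0 := by
    rw [← hS1, ← hS2]
    refine Finset.sum_congr rfl fun j hj => Finset.sum_congr rfl fun i hi => ?_
    exact hplaq i j (Finset.mem_range.1 hi) (Finset.mem_range.1 hj)
  linarith

/-- A measurable set that meets every translate of an `N × M` grid has measure at least
`1 / (N * M)`. -/
theorem one_le_mul_measure_of_grid {N M : ℕ} (hN : 0 < N) (hM : 0 < M) {S : Set (ℝ × ℝ)}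
    (hS : MeasurableSet S)
    (h : ∀ x y : ℝ, x ∈ Set.Ico 0 (1 / (N : ℝ)) → y ∈ Set.Ico 0 (1 / (M : ℝ)) →
      ∃ i < N, ∃ j < M, (x + i / N, y + j / M) ∈ S) :
    1 ≤ (N * M : ENNReal) * squareMeasure S := by
  have hN0 : (0 : ℝ) < N := by exact_mod_cast hN
  have hM0 : (0 : ℝ) < M := by exact_mod_cast hM
  set T : Set (ℝ × ℝ) := Set.Ico 0 (1 / (N : ℝ)) ×ˢ Set.Ico 0 (1 / (M : ℝ)) with hT
  let v : ℕ × ℕ → ℝ × ℝ := fun q => ((q.1 : ℝ) / N, (q.2 : ℝ) / M)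
  set I := Finset.range N ×ˢ Finset.range M with hI
  have hTm : MeasurableSet T := measurableSet_Ico.prod measurableSet_Ico
  have hTv : (volume : Measure (ℝ × ℝ)) T = (N * M : ENNReal)⁻¹ := by
    rw [hT, Measure.volume_eq_prod, Measure.prod_prod, Real.volume_Ico, Real.volume_Ico, sub_zero,
      sub_zero, ← ENNReal.ofReal_mul (by positivity),
      ENNReal.mul_inv (Or.inr (ENNReal.natCast_ne_top M)) (Or.inl (ENNReal.natCast_ne_top N)),
      ENNReal.ofReal_mul (by positivity), one_div, one_div, ENNReal.ofReal_inv_of_pos hN0,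
      ENNReal.ofReal_inv_of_pos hM0, ENNReal.ofReal_natCast, ENNReal.ofReal_natCast]
  -- The part of `S` in the grid cell labelled `q`. Moved back to the base cell these parts cover
  -- it, while in place they are disjoint, so their total measure is at least that of one cell.
  let D : ℕ × ℕ → Set (ℝ × ℝ) := fun q => S ∩ (fun p => p - v q) ⁻¹' T
  have hcov : T ⊆ ⋃ q ∈ I, (fun p => p + v q) ⁻¹' D q := by
    rintro ⟨x, y⟩ ⟨hx, hy⟩
    obtain ⟨i, hi, j, hj, hs⟩ := h x y hx hy
    refine Set.mem_biUnion (x := (i, j)) (by simp [hI, hi, hj]) ?_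
    refine ⟨hs, ?_⟩
    simp only [Set.mem_preimage, add_sub_cancel_right]
    exact ⟨hx, hy⟩
  have hDm (q : ℕ × ℕ) : MeasurableSet (D q) :=
    hS.inter (hTm.preimage (measurable_sub_const (v q)))
  have hmem (q : ℕ × ℕ) (p : ℝ × ℝ) (hp : p ∈ D q) :
      ⌊p.1 * N⌋ = q.1 ∧ ⌊p.2 * M⌋ = q.2 := by
    obtain ⟨-, ⟨h1, h2⟩, h3, h4⟩ := hp
    simp only [v, Prod.fst_sub, Prod.snd_sub, sub_nonneg, sub_lt_iff_lt_add] at h1 h2 h3 h4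
    rw [← add_div, lt_div_iff₀ (by assumption)] at h2 h4
    rw [div_le_iff₀ (by assumption)] at h1 h3
    constructor
    · rw [Int.floor_eq_iff]; push_cast; constructor <;> linarith
    · rw [Int.floor_eq_iff]; push_cast; constructor <;> linarith
  have hdisj : (I : Set (ℕ × ℕ)).PairwiseDisjoint D := by
    intro q _ q' _ hne
    refine Set.disjoint_left.2 fun p hp hp' => hne ?_
    have h1 := hmem q p hp
    have h2 := hmem q' p hp'
    ext
    · exact_mod_cast h1.1.symm.trans h2.1
    · exact_mod_cast h1.2.symm.trans h2.2
  have hsub : (⋃ q ∈ I, D q) ⊆ S ∩ Set.Ico 0 1 ×ˢ Set.Ico 0 1 := by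
    refine Set.iUnion₂_subset fun q hq p hp => ⟨hp.1, ?_⟩
    have hq' := Finset.mem_product.1 hq
    have h1 : q.1 < N := Finset.mem_range.1 hq'.1
    have h2 : q.2 < M := Finset.mem_range.1 hq'.2
    have h1' : (q.1 : ℝ) + 1 ≤ N := by exact_mod_cast h1
    have h2' : (q.2 : ℝ) + 1 ≤ M := by exact_mod_cast h2
    obtain ⟨e1, e2⟩ := hmem q p hp
    rw [Int.floor_eq_iff] at e1 e2
    push_cast at e1 e2
    have h3 : (0 : ℝ) ≤ q.1 := by positivity
    have h4 : (0 : ℝ) ≤ q.2 := by positivity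
    refine ⟨⟨?_, ?_⟩, ?_, ?_⟩
    · exact nonneg_of_mul_nonneg_left (h3.trans e1.1) hN0
    · exact lt_of_mul_lt_mul_right (by linarith [e1.2] : p.1 * N < 1 * N) hN0.le
    · exact nonneg_of_mul_nonneg_left (h4.trans e2.1) hM0
    · exact lt_of_mul_lt_mul_right (by linarith [e2.2] : p.2 * M < 1 * M) hM0.le
  have hmain : (N * M : ENNReal)⁻¹ ≤ squareMeasure S := by
    calc (N * M : ENNReal)⁻¹ = volume T := hTv.symm
      _ ≤ ∑ q ∈ I, volume ((fun p => p + v q) ⁻¹' D q) :=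
          (measure_mono hcov).trans (measure_biUnion_finset_le _ _)
      _ = ∑ q ∈ I, volume (D q) :=
          Finset.sum_congr rfl fun q _ => measure_preimage_add_right volume (v q) (D q)
      _ = volume (⋃ q ∈ I, D q) := (measure_biUnion_finset hdisj fun q _ => hDm q).symm
      _ ≤ volume (S ∩ Set.Ico 0 1 ×ˢ Set.Ico 0 1) := measure_mono hsub
      _ = squareMeasure S := by rw [squareMeasure_eq_restrict, Measure.restrict_apply hS]
  have hne : (N * M : ENNReal) ≠ 0 := by
    simp [hN.ne', hM.ne']
  have hnt : (N * M : ENNReal) ≠ ⊤ :=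
    ENNReal.mul_ne_top (ENNReal.natCast_ne_top N) (ENNReal.natCast_ne_top M)
  rw [← ENNReal.mul_inv_cancel hne hnt]
  gcongr

/-! ### Quasi-periodic functions and combinations of their translates -/

/-- Quasi-periodicity of a Zak transform. -/
structure IsQuasiPeriodic (F : ℝ × ℝ → ℂ) : Prop where
  add_one_fst : ∀ x y, F (x + 1, y) = expi y * F (x, y)
  add_one_snd : ∀ x y, F (x, y + 1) = F (x, y)

namespace IsQuasiPeriodic

variable {F : ℝ × ℝ → ℂ}

theorem add_intCast_fst (hF : IsQuasiPeriodic F) (x y : ℝ) (n : ℤ) :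
    F (x + n, y) = expi (n * y) * F (x, y) := by
  induction n using Int.induction_on with
  | zero => simp
  | succ k ih =>
    have : x + ((k + 1 : ℤ) : ℝ) = x + (k : ℤ) + 1 := by push_cast; ring
    rw [this, hF.add_one_fst, ih, ← mul_assoc, ← expi_add]
    congr 2
    push_cast
    ring
  | pred k ih =>
    have h := hF.add_one_fst (x + ((-k - 1 : ℤ) : ℝ)) y
    have e : x + ((-k - 1 : ℤ) : ℝ) + 1 = x + ((-k : ℤ) : ℝ) := by push_cast; ring
    rw [e, ih] at h
    refine mul_left_cancel₀ (expi_ne_zero y) ?_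
    rw [← h, ← mul_assoc, ← expi_add]
    congr 2
    push_cast
    ring

theorem eq_fract (hF : IsQuasiPeriodic F) (x y : ℝ) :
    F (x, y) = expi (⌊x⌋ * y) * F (Int.fract x, y) := by
  rw [← hF.add_intCast_fst, Int.fract_add_floor]

theorem zakInv_eq (hF : IsQuasiPeriodic F) (t : ℝ) :
    zakInv F t = ∫ y, F (t, y) ∂unitMeasure := by
  simp only [zakInv, ← hF.eq_fract]

theorem integral_add_snd (hF : IsQuasiPeriodic F) (t s : ℝ) :
    ∫ y, F (t, y + s) ∂unitMeasure = ∫ y, F (t, y) ∂unitMeasure := by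
  rw [integral_unitMeasure, integral_unitMeasure,
    intervalIntegral.integral_comp_add_right (fun y => F (t, y)) s]
  have hp : Function.Periodic (fun y => F (t, y)) 1 := fun y => hF.add_one_snd t y
  have := hp.intervalIntegral_add_eq s 0
  rw [zero_add] at this
  rw [zero_add, add_comm 1 s, this]

theorem comp_add_fst (hF : IsQuasiPeriodic F) (s : ℝ) :
    IsQuasiPeriodic fun z => F (z.1 + s, z.2) where
  add_one_fst x y := by
    simp only []
    rw [← hF.add_one_fst]; congr 2; ring
  add_one_snd x y := hF.add_one_snd _ _

/-- A plain shift in `y` would change the multiplier `e^{2πiy}` of the first period; the factor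
`e^{-2πisx}` compensates. -/
theorem modulate (hF : IsQuasiPeriodic F) (s : ℝ) :
    IsQuasiPeriodic fun z => expi (-(s * z.1)) * F (z.1, z.2 + s) where
  add_one_fst x y := by
    simp only [hF.add_one_fst]
    have : expi (-(s * (x + 1))) * expi (y + s) = expi y * expi (-(s * x)) := by
      rw [← expi_add, ← expi_add]; congr 1; ring
    rw [← mul_assoc, ← mul_assoc, this]
  add_one_snd x y := by
    simp only []
    rw [← hF.add_one_snd x (y + s)]
    congr 3; ring

theorem tsum {Φ : ℤ → ℝ × ℝ → ℂ} (hΦ : ∀ j, IsQuasiPeriodic (Φ j)) (c : ℤ → ℂ) :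
    IsQuasiPeriodic fun z => ∑' j, c j * Φ j z where
  add_one_fst x y := by
    simp only [(hΦ _).add_one_fst, mul_left_comm _ (expi y), tsum_mul_left]
  add_one_snd x y := by simp only [(hΦ _).add_one_snd]

theorem zakInv_comp_add_fst (hF : IsQuasiPeriodic F) (s t : ℝ) :
    zakInv (fun z => F (z.1 + s, z.2)) t = zakInv F (t + s) := by
  rw [(hF.comp_add_fst s).zakInv_eq, hF.zakInv_eq]

/-- For fixed `t` the modulation is constant in `y`, and a shift in `y` does not change the integral
over a period. -/
theorem zakInv_modulate (hF : IsQuasiPeriodic F) (s t : ℝ) :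
    zakInv (fun z => expi (-(s * z.1)) * F (z.1, z.2 + s)) t = expi (-(s * t)) * zakInv F t := by
  rw [(hF.modulate s).zakInv_eq, hF.zakInv_eq, ← hF.integral_add_snd t s]
  exact integral_const_mul (L := ℂ) (expi (-(s * t))) fun y => F (t, y + s)

theorem norm_zakInv_le (hF : IsQuasiPeriodic F) {b : ℝ} (hb : ∀ z, ‖F z‖ ≤ b) (t : ℝ) :
    ‖zakInv F t‖ ≤ b := by
  rw [hF.zakInv_eq]
  simpa using norm_integral_le_of_norm_le_const (μ := unitMeasure)
    (Filter.Eventually.of_forall fun y => hb (t, y))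

end IsQuasiPeriodic

theorem StronglyMeasurable.tsum_const_mul {α : Type*} [MeasurableSpace α] {Φ : ℤ → α → ℂ}
    (hΦ : ∀ j, StronglyMeasurable (Φ j)) {b : ℝ} (hb : ∀ j z, ‖Φ j z‖ ≤ b) {c : ℤ → ℂ}
    (hc : Summable fun j => ‖c j‖) : StronglyMeasurable fun z => ∑' j, c j * Φ j z := by
  have hs (z : α) : HasSum (fun j => c j * Φ j z) (∑' j, c j * Φ j z) := by
    refine (Summable.of_norm_bounded (hc.mul_right b) fun j => ?_).hasSum
    rw [norm_mul]
    exact mul_le_mul_of_nonneg_left (hb j z) (norm_nonneg _)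
  refine stronglyMeasurable_of_tendsto (Filter.atTop : Filter (Finset ℤ))
    (f := fun S z => ∑ j ∈ S, c j * Φ j z) (fun S => ?_) (tendsto_pi_nhds.2 fun z => hs z)
  exact Finset.stronglyMeasurable_fun_sum S fun j _ => (hΦ j).const_mul (c j)

theorem norm_tsum_mul_le {c x : ℤ → ℂ} (hc : Summable fun j => ‖c j‖) {b : ℝ}
    (hb : ∀ j, ‖x j‖ ≤ b) : ‖∑' j, c j * x j‖ ≤ (∑' j, ‖c j‖) * b := by
  have h (j : ℤ) : ‖c j * x j‖ ≤ ‖c j‖ * b := by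
    rw [norm_mul]
    exact mul_le_mul_of_nonneg_left (hb j) (norm_nonneg _)
  have hs := Summable.of_nonneg_of_le (fun _ => norm_nonneg _) h (hc.mul_right b)
  calc ‖∑' j, c j * x j‖ ≤ ∑' j, ‖c j * x j‖ := norm_tsum_le_tsum_norm hs
    _ ≤ ∑' j, ‖c j‖ * b := hs.tsum_le_tsum h (hc.mul_right b)
    _ = _ := tsum_mul_right

theorem zakInv_tsum {Φ : ℤ → ℝ × ℝ → ℂ} (hq : ∀ j, IsQuasiPeriodic (Φ j))
    (hΦ : ∀ j, StronglyMeasurable (Φ j)) {b : ℝ} (hb : ∀ j z, ‖Φ j z‖ ≤ b) {c : ℤ → ℂ}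
    (hc : Summable fun j => ‖c j‖) (t : ℝ) :
    zakInv (fun z => ∑' j, c j * Φ j z) t = ∑' j, c j * zakInv (Φ j) t := by
  rw [(IsQuasiPeriodic.tsum hq c).zakInv_eq]
  simp only [(hq _).zakInv_eq]
  have hn (j : ℤ) (y : ℝ) : ‖c j * Φ j (t, y)‖ ≤ ‖c j‖ * b := by
    rw [norm_mul]
    exact mul_le_mul_of_nonneg_left (hb j _) (norm_nonneg _)
  have hi (j : ℤ) : Integrable (fun y => c j * Φ j (t, y)) unitMeasure :=
    Integrable.of_bound (((hΦ j).comp_measurable measurable_prodMk_left).const_mul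
      (c j)).aestronglyMeasurable (‖c j‖ * b) (Filter.Eventually.of_forall (hn j))
  have := hasSum_integral_of_summable_integral_norm hi
    (Summable.of_nonneg_of_le (fun j => integral_nonneg fun y => norm_nonneg _)
      (fun j => ?_) (hc.mul_right b))
  · rw [← this.tsum_eq]
    simp only [integral_const_mul]
  · calc ∫ y, ‖c j * Φ j (t, y)‖ ∂unitMeasure ≤ ∫ y, ‖c j‖ * b ∂unitMeasure :=
          integral_mono (hi j).norm (integrable_const _) (hn j)
      _ = ‖c j‖ * b := by simp

theorem memLp_of_bound {α : Type*} [MeasurableSpace α] {μ : Measure α} [IsFiniteMeasure μ]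
    {F : α → ℂ} (hF : StronglyMeasurable F) {b : ℝ} (hb : ∀ z, ‖F z‖ ≤ b) : MemLp F 2 μ :=
  MemLp.of_bound hF.aestronglyMeasurable b (Filter.Eventually.of_forall hb)

section Combinations

variable {F : ℝ × ℝ → ℂ} {b : ℝ} {c : ℤ → ℂ}

/-- Combinations of translates of a Zak transform in the first variable. -/
theorem lintegral_tsum_comp_add_fst (hq : IsQuasiPeriodic F) (hF : StronglyMeasurable F)
    (hb : ∀ z, ‖F z‖ ≤ b) (hc : Summable fun j => ‖c j‖) (hg : MemLp (zakInv F) 2 volume) (h : ℝ) :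
    ∫⁻ z, ‖∑' j : ℤ, c j * F (z.1 + j * h, z.2)‖ₑ ^ 2 ∂squareMeasure
      = ∫⁻ ξ, ‖∑' j : ℤ, c j * expi (j * (h * ξ))‖ₑ ^ 2
          * ‖(𝓕 (hg.toLp (zakInv F)) : L2R) ξ‖ₑ ^ 2 := by
  have hm (j : ℤ) : StronglyMeasurable fun z : ℝ × ℝ => F (z.1 + j * h, z.2) :=
    hF.comp_measurable (by fun_prop)
  have hU := StronglyMeasurable.tsum_const_mul hm (fun j z => hb _) hc
  have hUb (z : ℝ × ℝ) : ‖∑' j : ℤ, c j * F (z.1 + j * h, z.2)‖ ≤ (∑' j, ‖c j‖) * b :=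
    norm_tsum_mul_le hc fun j => hb _
  -- The inverse Zak transform turns the combination into the same combination of time translates,
  -- to which Plancherel applies.
  rw [← lintegral_zakInv hU (memLp_of_bound hU hUb)]
  simp only [← mul_assoc]
  rw [← lintegral_tsum_translate hg (fun t => hq.norm_zakInv_le hb t) hc]
  refine lintegral_congr fun t => ?_
  rw [zakInv_tsum (fun j => hq.comp_add_fst (j * h)) hm (fun j z => hb _) hc]
  simp only [hq.zakInv_comp_add_fst]

/-- Combinations of modulated translates of a Zak transform in the second variable. -/
theorem lintegral_tsum_modulate (hq : IsQuasiPeriodic F) (hF : StronglyMeasurable F)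
    (hb : ∀ z, ‖F z‖ ≤ b) (hc : Summable fun j => ‖c j‖) (h : ℝ) :
    ∫⁻ z, ‖∑' j : ℤ, c j * (expi (-(j * h * z.1)) * F (z.1, z.2 + j * h))‖ₑ ^ 2 ∂squareMeasure
      = ∫⁻ t, ‖∑' j : ℤ, c j * expi (j * (-h * t))‖ₑ ^ 2 * ‖zakInv F t‖ₑ ^ 2 := by
  have hm (j : ℤ) : StronglyMeasurable
      fun z : ℝ × ℝ => expi (-(j * h * z.1)) * F (z.1, z.2 + j * h) := by
    refine StronglyMeasurable.mul (Measurable.stronglyMeasurable (by fun_prop)) ?_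
    exact hF.comp_measurable (by fun_prop)
  have hjb (j : ℤ) (z : ℝ × ℝ) : ‖expi (-(j * h * z.1)) * F (z.1, z.2 + j * h)‖ ≤ b := by
    simpa using hb _
  have hU := StronglyMeasurable.tsum_const_mul hm hjb hc
  have hUb (z : ℝ × ℝ) := norm_tsum_mul_le hc fun j => hjb j z
  -- Here the inverse Zak transform directly yields a multiplier on the time side; no Fourier
  -- transform is involved.
  rw [← lintegral_zakInv hU (memLp_of_bound hU hUb)]
  refine lintegral_congr fun t => ?_
  rw [zakInv_tsum (fun j => hq.modulate (j * h)) hm hjb hc]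
  simp only [hq.zakInv_modulate]
  rw [← mul_pow, ← enorm_mul, ← tsum_mul_right]
  refine congrArg (fun w : ℂ => ‖w‖ₑ ^ 2) (tsum_congr fun j => ?_)
  rw [← mul_assoc]
  congr 3
  ring

end Combinations

/-- The quasi-periodic extension of a function on `[0, 1)²`. -/
noncomputable def quasiExtend (f : ℝ × ℝ → ℂ) (z : ℝ × ℝ) : ℂ :=
  expi (⌊z.1⌋ * z.2) * f (Int.fract z.1, Int.fract z.2)

theorem isQuasiPeriodic_quasiExtend (f : ℝ × ℝ → ℂ) : IsQuasiPeriodic (quasiExtend f) where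
  add_one_fst x y := by
    simp only [quasiExtend, Int.floor_add_one, Int.fract_add_one, ← mul_assoc, ← expi_add]
    congr 2
    push_cast
    ring
  add_one_snd x y := by
    simp only [quasiExtend, Int.fract_add_one]
    rw [mul_add, mul_one, expi_add_intCast]

theorem quasiExtend_of_mem (f : ℝ × ℝ → ℂ) {z : ℝ × ℝ} (h1 : z.1 ∈ Set.Ico (0 : ℝ) 1)
    (h2 : z.2 ∈ Set.Ico (0 : ℝ) 1) : quasiExtend f z = f z := by
  simp [quasiExtend, Int.floor_eq_zero_iff.2 h1, Int.fract_eq_self.2 h1, Int.fract_eq_self.2 h2]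

theorem quasiExtend_ae_eq (f : ℝ × ℝ → ℂ) : quasiExtend f =ᵐ[squareMeasure] f := by
  filter_upwards [ae_squareMeasure_mem] with z hz
  exact quasiExtend_of_mem f hz.1 hz.2

theorem stronglyMeasurable_quasiExtend {f : ℝ × ℝ → ℂ} (hf : StronglyMeasurable f) :
    StronglyMeasurable (quasiExtend f) := by
  have h : Measurable fun z : ℝ × ℝ => ((⌊z.1⌋ : ℤ) : ℝ) :=
    measurable_from_top.comp (Int.measurable_floor.comp measurable_fst)
  refine StronglyMeasurable.mul (Measurable.stronglyMeasurable (by fun_prop)) ?_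
  exact hf.comp_measurable (by fun_prop)

theorem norm_quasiExtend (f : ℝ × ℝ → ℂ) (z : ℝ × ℝ) :
    ‖quasiExtend f z‖ = ‖f (Int.fract z.1, Int.fract z.2)‖ := by
  simp [quasiExtend]

/-! ### The lower bound -/

theorem measurableSet_le_abs (R : ℝ) : MeasurableSet {t : ℝ | R ≤ |t|} :=
  measurableSet_le measurable_const measurable_norm

theorem ofReal_timeFreqTail (g : L2R) (R L : ℝ) :
    ENNReal.ofReal (timeFreqTail g R L) = (∫⁻ t in {t : ℝ | R ≤ |t|}, ‖g t‖ₑ ^ 2)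
      + ∫⁻ ξ in {ξ : ℝ | L ≤ |ξ|}, ‖(𝓕 g : L2R) ξ‖ₑ ^ 2 := by
  rw [lintegral_enorm_sq_eq_ofReal ((Lp.memLp g).restrict _),
    lintegral_enorm_sq_eq_ofReal ((Lp.memLp (𝓕 g : L2R)).restrict _), timeFreqTail,
    ENNReal.ofReal_add]
  · exact integral_nonneg fun _ => by positivity
  · exact integral_nonneg fun _ => by positivity

theorem lintegral_mul_le_tail {w : ℝ → ℂ} {L : ℝ} (hw : ∀ ξ, ‖w ξ‖ ≤ 3)
    (h0 : ∀ ξ, |ξ| < L → w ξ = 0) (k : ℝ → ENNReal) :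
    ∫⁻ ξ, ‖w ξ‖ₑ ^ 2 * k ξ ≤ 9 * ∫⁻ ξ in {ξ : ℝ | L ≤ |ξ|}, k ξ := by
  rw [← lintegral_const_mul' _ _ (by simp), ← lintegral_indicator (measurableSet_le_abs L)]
  refine lintegral_mono fun ξ => ?_
  by_cases hξ : L ≤ |ξ|
  · rw [Set.indicator_of_mem (show ξ ∈ {ξ : ℝ | L ≤ |ξ|} from hξ)]
    have : ‖w ξ‖ₑ ≤ 3 := by
      rw [← ofReal_norm]
      exact (ENNReal.ofReal_le_ofReal (hw ξ)).trans (by simp)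
    calc ‖w ξ‖ₑ ^ 2 * k ξ ≤ 3 ^ 2 * k ξ := by gcongr
      _ = 9 * k ξ := by norm_num
  · simp [h0 ξ (not_le.1 hξ)]

/-- Chebyshev's inequality for the variation of a bounded family. -/
theorem measure_variation_le {Φ : ℤ → ℝ × ℝ → ℂ} (hΦ : ∀ j, StronglyMeasurable (Φ j)) {a b : ℝ}
    (ha : 0 < a) (hb : ∀ j z, ‖Φ j z‖ ≤ b) {c : ℤ → ℂ} (hc : Summable fun j => ‖c j‖)
    (hx : ∀ z, ‖Φ 1 z - Φ 0 z - ∑' j, c j * Φ j z‖ ≤ a / 4) :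
    ENNReal.ofReal (a ^ 2 / 16) * squareMeasure {z | a / 2 ≤ ‖Φ 1 z - Φ 0 z‖}
      ≤ ∫⁻ z, ‖∑' j, c j * Φ j z‖ₑ ^ 2 ∂squareMeasure := by
  have hU := StronglyMeasurable.tsum_const_mul hΦ hb hc
  refine le_trans ?_ (mul_meas_ge_le_lintegral₀ (hU.enorm.pow_const 2).aemeasurable
    (ENNReal.ofReal (a ^ 2 / 16)))
  gcongr with z
  intro hz
  have h1 : a / 4 ≤ ‖∑' j, c j * Φ j z‖ := by
    have := norm_sub_norm_le (Φ 1 z - Φ 0 z) (∑' j, c j * Φ j z)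
    linarith [hx z]
  rw [← ofReal_norm, ← ENNReal.ofReal_pow (norm_nonneg _)]
  refine ENNReal.ofReal_le_ofReal ?_
  calc a ^ 2 / 16 = (a / 4) ^ 2 := by ring
    _ ≤ _ := pow_le_pow_left₀ (by positivity) h1 2

section LowerBound

variable {F : ℝ × ℝ → ℂ} {a b : ℝ}

/-- The grid lemma gives a plain step of size at least `3a/4`. In the second variable the modulation
changes the step by at most `2πb/M ≤ a/4`, which leaves `a/2`. -/
theorem exists_variation_of_quasiPeriodic (hq : IsQuasiPeriodic F) (ha : 0 < a)
    (hF : ∀ z, a ≤ ‖F z‖ ∧ ‖F z‖ ≤ b) {N M : ℕ} (hN : 0 < N) (hM : 3 ≤ M)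
    (hMb : 8 * Real.pi * b ≤ a * M) {x y : ℝ} (hx : x ∈ Set.Ico 0 (1 / (N : ℝ))) :
    ∃ i < N, ∃ j < M, (x + i / N, y + j / M) ∈
      {z | a / 2 ≤ ‖F (z.1 + 1 / N, z.2) - F z‖}
        ∪ {z | a / 2 ≤ ‖expi (-(1 / M * z.1)) * F (z.1, z.2 + 1 / M) - F z‖} := by
  have hN0 : (0 : ℝ) < N := by exact_mod_cast hN
  have hM0 : (0 : ℝ) < M := by exact_mod_cast (by omega : 0 < M)
  have hb : 0 < b := ha.trans_le ((hF 0).1.trans (hF 0).2)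
  have hpi := Real.pi_pos
  obtain ⟨i, hi, j, hj, h⟩ := exists_large_variation (N := N) (M := M)
    (f := fun i j => F (x + i / N, y + j / M)) (y := y) hN hM
    (fun i j h0 => by have := (hF (x + i / N, y + j / M)).1; simp [h0] at this; linarith)
    (fun i => by
      simp only [div_self hM0.ne', Nat.cast_zero, zero_div, add_zero, hq.add_one_snd])
    (fun j => by
      simp only [div_self hN0.ne', Nat.cast_zero, zero_div, add_zero, hq.add_one_fst])
  refine ⟨i, hi, j, hj, ?_⟩
  set z : ℝ × ℝ := (x + i / N, y + j / M) with hz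
  have hz0 := hF z
  rcases h with h | h
  · left
    have e : x + ((i + 1 : ℕ) : ℝ) / N = x + i / N + 1 / N := by push_cast; ring
    simp only [e] at h
    simp only [Set.mem_ofPred_eq]
    linarith
  · right
    have e : y + ((j + 1 : ℕ) : ℝ) / M = y + j / M + 1 / M := by push_cast; ring
    simp only [e] at h
    simp only [Set.mem_ofPred_eq]
    have hz1 : 0 ≤ z.1 ∧ z.1 ≤ 1 := by
      have h1 : (i : ℝ) + 1 ≤ N := by exact_mod_cast hi
      have h2 : x + i / N ≤ (i + 1) / N := by rw [add_div]; linarith [hx.2]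
      refine ⟨add_nonneg hx.1 (by positivity), h2.trans ?_⟩
      rw [div_le_one hN0]; exact h1
    have h3 : ‖expi (-(1 / M * z.1)) - 1‖ ≤ 2 * Real.pi / M := by
      refine (norm_expi_sub_one_le _).trans ?_
      rw [abs_neg, abs_of_nonneg (mul_nonneg (by positivity) hz1.1)]
      calc 2 * Real.pi * (1 / M * z.1) ≤ 2 * Real.pi * (1 / M * 1) := by
            gcongr; exact hz1.2
        _ = _ := by ring
    have h4 : 2 * Real.pi / M * b ≤ a / 4 := by
      rw [div_mul_eq_mul_div, div_le_iff₀ hM0]; linarith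
    set w := F (z.1, z.2 + 1 / M) with hw
    have h5 : ‖(expi (-(1 / M * z.1)) - 1) * w‖ ≤ a / 4 := by
      rw [norm_mul]
      exact (mul_le_mul h3 (hF _).2 (norm_nonneg _) (by positivity)).trans h4
    have h6 := norm_sub_le (expi (-(1 / M * z.1)) * w - F z) ((expi (-(1 / M * z.1)) - 1) * w)
    have e2 : expi (-(1 / M * z.1)) * w - F z - (expi (-(1 / M * z.1)) - 1) * w = w - F z := by ring
    rw [e2] at h6
    have h7 : 3 / 4 * ‖F z‖ ≤ ‖w - F z‖ := h
    linarith

/-- The quantitative Balian–Low inequality in terms of a quasi-periodic function. -/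
theorem exists_tail_bound (ha : 0 < a) (b : ℝ) : ∃ K : ℝ, 1 ≤ K ∧ ∀ F : ℝ × ℝ → ℂ,
    IsQuasiPeriodic F → StronglyMeasurable F → (∀ z, a ≤ ‖F z‖ ∧ ‖F z‖ ≤ b) →
    ∀ hg : MemLp (zakInv F) 2 volume, ∀ R L : ℝ, 1 ≤ R → 1 ≤ L →
      a ^ 2 / 144 ≤ (K * L) * (K * R) * timeFreqTail (hg.toLp (zakInv F)) R L := by
  rcases lt_or_ge b a with hba | hba
  · exact ⟨1, le_rfl, fun F _ _ h => absurd ((h 0).1.trans (h 0).2) (not_le.2 hba)⟩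
  have hb0 : 0 < b := ha.trans_le hba
  have hpi := Real.pi_pos
  -- With this `ε` the replacement error is `εb = a/4`, half of the step size `a/2` to be detected.
  obtain ⟨δ, hδ, c, hc, hc3, hcθ, hcx⟩ := exists_summable_near_difference
    (ε := a / (4 * b)) (by positivity) (by rw [div_le_one (by positivity)]; linarith)
  -- The three entries ensure that the multiplier vanishes below the cutoffs, that the modulation
  -- error is at most `a/4`, and that `M ≥ 3`.
  set K₀ : ℝ := max (1 / δ) (max (8 * Real.pi * b / a) 3) with hK₀
  have hK1 : 1 / δ ≤ K₀ := le_max_left _ _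
  have hK2 : 8 * Real.pi * b / a ≤ K₀ := (le_max_left _ _).trans (le_max_right _ _)
  have hK3 : 3 ≤ K₀ := (le_max_right _ _).trans (le_max_right _ _)
  refine ⟨K₀ + 1, by linarith, fun F hq hF hab hg R L hR hL => ?_⟩
  have hceil (r : ℝ) (hr : 1 ≤ r) : K₀ * r ≤ ⌈K₀ * r⌉₊ ∧ (⌈K₀ * r⌉₊ : ℝ) ≤ (K₀ + 1) * r ∧
      3 ≤ ⌈K₀ * r⌉₊ := by
    have h3 : 3 ≤ K₀ * r := by nlinarith
    have h1 := Nat.le_ceil (K₀ * r)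
    refine ⟨h1, ?_, by exact_mod_cast h3.trans h1⟩
    have := Nat.ceil_lt_add_one (show 0 ≤ K₀ * r by linarith)
    nlinarith
  set N := ⌈K₀ * L⌉₊ with hN
  set M := ⌈K₀ * R⌉₊ with hM
  obtain ⟨hN1, hN2, hN3⟩ := hceil L hL
  obtain ⟨hM1, hM2, hM3⟩ := hceil R hR
  have hN0 : (0 : ℝ) < N := by exact_mod_cast (by omega : 0 < N)
  have hM0 : (0 : ℝ) < M := by exact_mod_cast (by omega : 0 < M)
  have hb (z : ℝ × ℝ) : ‖F z‖ ≤ b := (hab z).2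
  have hε : a / (4 * b) * b = a / 4 := by field_simp
  have hsmall {r ξ : ℝ} {n : ℕ} (hn0 : (0 : ℝ) < n) (hn : K₀ * r ≤ n) (hr : 1 ≤ r) (hξ : |ξ| < r) :
      |1 / (n : ℝ) * ξ| ≤ δ := by
    rw [abs_mul, abs_of_pos (one_div_pos.2 hn0), one_div, inv_mul_le_iff₀ hn0]
    have : 1 ≤ K₀ * δ := by rwa [div_le_iff₀ hδ] at hK1
    nlinarith
  have hnorm (θ : ℝ) : ‖∑' j : ℤ, c j * expi (j * θ)‖ ≤ 3 := by
    have := norm_tsum_mul_le hc (x := fun j : ℤ => expi (j * θ)) (b := 1) (fun j => by simp)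
    linarith
  set g := hg.toLp (zakInv F) with hgdef
  -- With `N ≥ K₀L`, every `|ξ| < L` satisfies `|ξ/N| ≤ δ`, so only the tail survives, with squared
  -- multiplier at most `9`.
  have hfreq : ENNReal.ofReal (a ^ 2 / 16) *
      squareMeasure {z | a / 2 ≤ ‖F (z.1 + 1 / N, z.2) - F z‖}
        ≤ 9 * ∫⁻ ξ in {ξ : ℝ | L ≤ |ξ|}, ‖(𝓕 g : L2R) ξ‖ₑ ^ 2 := by
    have h1 := measure_variation_le
      (Φ := fun j z => F (z.1 + j * (1 / N), z.2)) (fun j => hF.comp_measurable (by fun_prop)) ha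
      (fun j z => hb _) hc (fun z => by
        rw [← hε]; exact hcx (fun j => F (z.1 + j * (1 / N), z.2)) b fun j => hb _)
    rw [lintegral_tsum_comp_add_fst hq hF hb hc hg] at h1
    simp only [Int.cast_one, one_mul, Int.cast_zero, zero_mul, add_zero] at h1
    exact h1.trans (lintegral_mul_le_tail (fun ξ => hnorm _)
      (fun ξ hξ => hcθ _ (hsmall hN0 hN1 hL hξ)) _)
  have htime : ENNReal.ofReal (a ^ 2 / 16) *
      squareMeasure {z | a / 2 ≤ ‖expi (-(1 / M * z.1)) * F (z.1, z.2 + 1 / M) - F z‖}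
        ≤ 9 * ∫⁻ t in {t : ℝ | R ≤ |t|}, ‖g t‖ₑ ^ 2 := by
    have h1 := measure_variation_le
      (Φ := fun j z => expi (-(j * (1 / M) * z.1)) * F (z.1, z.2 + j * (1 / M)))
      (fun j => StronglyMeasurable.mul (Measurable.stronglyMeasurable (by fun_prop))
        (hF.comp_measurable (by fun_prop))) ha
      (fun j z => by simpa using hb _) hc (fun z => by
        rw [← hε]
        exact hcx (fun j => expi (-(j * (1 / M) * z.1)) * F (z.1, z.2 + j * (1 / M))) b
          fun j => by simpa using hb _)
    rw [lintegral_tsum_modulate hq hF hb hc] at h1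
    simp only [Int.cast_one, one_mul, Int.cast_zero, zero_mul, add_zero, neg_zero, expi_zero] at h1
    refine h1.trans ((lintegral_mul_le_tail (L := R) (fun t => hnorm _)
      (fun t ht => hcθ _ ?_) _).trans (le_of_eq ?_))
    · rw [neg_mul, abs_neg]
      exact hsmall hM0 hM1 hR ht
    · congr 1
      refine lintegral_congr_ae (ae_restrict_of_ae ?_)
      filter_upwards [hg.coeFn_toLp] with t ht
      rw [hgdef, ht]
  set S₁ : Set (ℝ × ℝ) := {z | a / 2 ≤ ‖F (z.1 + 1 / N, z.2) - F z‖} with hS₁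
  set S₂ : Set (ℝ × ℝ) :=
    {z | a / 2 ≤ ‖expi (-(1 / M * z.1)) * F (z.1, z.2 + 1 / M) - F z‖} with hS₂
  have hmS₁ : MeasurableSet S₁ := measurableSet_le measurable_const
    ((hF.comp_measurable (by fun_prop)).sub hF).norm.measurable
  have hmS₂ : MeasurableSet S₂ := by
    refine measurableSet_le measurable_const (StronglyMeasurable.measurable ?_)
    exact ((StronglyMeasurable.mul (Measurable.stronglyMeasurable (by fun_prop))
      (hF.comp_measurable (by fun_prop))).sub hF).norm
  have hMb : 8 * Real.pi * b ≤ a * M := by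
    rw [div_le_iff₀ ha] at hK2
    have h1 : K₀ ≤ M := le_trans (by nlinarith) hM1
    nlinarith
  have hgrid := one_le_mul_measure_of_grid (N := N) (M := M) (by omega) (by omega)
    (hmS₁.union hmS₂) (fun x y hx _ => exists_variation_of_quasiPeriodic hq ha hab (by omega) hM3
      hMb hx)
  have htail0 : 0 ≤ timeFreqTail g R L :=
    add_nonneg (integral_nonneg fun _ => by positivity) (integral_nonneg fun _ => by positivity)
  have hfinal : ENNReal.ofReal (a ^ 2 / 16) ≤
      ENNReal.ofReal (N * M * (9 * timeFreqTail g R L)) := by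
    calc ENNReal.ofReal (a ^ 2 / 16)
        ≤ ENNReal.ofReal (a ^ 2 / 16) * ((N * M : ENNReal) * squareMeasure (S₁ ∪ S₂)) :=
          le_mul_of_one_le_right' hgrid
      _ ≤ ENNReal.ofReal (a ^ 2 / 16) * ((N * M : ENNReal) *
            (squareMeasure S₁ + squareMeasure S₂)) := by
          gcongr; exact measure_union_le _ _
      _ = (N * M : ENNReal) * (ENNReal.ofReal (a ^ 2 / 16) * squareMeasure S₁
            + ENNReal.ofReal (a ^ 2 / 16) * squareMeasure S₂) := by ring
      _ ≤ (N * M : ENNReal) * (9 * (∫⁻ ξ in {ξ : ℝ | L ≤ |ξ|}, ‖(𝓕 g : L2R) ξ‖ₑ ^ 2)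
            + 9 * ∫⁻ t in {t : ℝ | R ≤ |t|}, ‖g t‖ₑ ^ 2) := by gcongr
      _ = (N * M : ENNReal) * (9 * ENNReal.ofReal (timeFreqTail g R L)) := by
          rw [ofReal_timeFreqTail]; ring
      _ = ENNReal.ofReal (N * M * (9 * timeFreqTail g R L)) := by
          rw [ENNReal.ofReal_mul (by positivity), ENNReal.ofReal_mul (by positivity),
            ENNReal.ofReal_mul (by norm_num), ENNReal.ofReal_natCast, ENNReal.ofReal_natCast]
          simp
  rw [ENNReal.ofReal_le_ofReal_iff (by positivity)] at hfinal
  have h1 : (N : ℝ) * M ≤ (K₀ + 1) * L * ((K₀ + 1) * R) := mul_le_mul hN2 hM2 hM0.le (by positivity)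
  have h2 := mul_le_mul_of_nonneg_right h1 htail0
  linarith

end LowerBound

/-- The grid argument evaluates `F` at individual points, so the Zak transform is first redefined on
a null set to make its bounds hold everywhere, then extended quasi-periodically. -/
theorem exists_quasiPeriodic_of_isRieszBasisWithBounds {g : L2R} {A B : ℝ}
    (h : IsRieszBasisWithBounds (gaborSystem g) A B) :
    ∃ F : ℝ × ℝ → ℂ, IsQuasiPeriodic F ∧ StronglyMeasurable F ∧
      (∀ z, √A ≤ ‖F z‖ ∧ ‖F z‖ ≤ √B) ∧ ∃ hg : MemLp (zakInv F) 2 volume, g = hg.toLp _ := by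
  obtain ⟨f, rfl⟩ := zakInvEquiv.surjective g
  have hbd : ∀ᵐ z ∂squareMeasure, √A ≤ ‖f z‖ ∧ ‖f z‖ ≤ √B := by
    filter_upwards [ae_bounds_of_isRieszBasisWithBounds h] with z hz
    exact ⟨Real.sqrt_le_iff.2 ⟨norm_nonneg _, hz.1⟩, Real.le_sqrt_of_sq_le hz.2⟩
  have hAB : √A ≤ √B := by
    obtain ⟨z, hz⟩ := hbd.exists
    exact hz.1.trans hz.2
  have hfm := Lp.stronglyMeasurable f
  set E : Set (ℝ × ℝ) := {z | √A ≤ ‖f z‖ ∧ ‖f z‖ ≤ √B} with hE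
  have hEm : MeasurableSet E :=
    (measurableSet_le measurable_const hfm.norm.measurable).inter
      (measurableSet_le hfm.norm.measurable measurable_const)
  classical
  set f' : ℝ × ℝ → ℂ := fun z => if z ∈ E then f z else (√A : ℂ) with hf'
  have hf'm : StronglyMeasurable f' := StronglyMeasurable.ite hEm hfm stronglyMeasurable_const
  have hf'b (z : ℝ × ℝ) : √A ≤ ‖f' z‖ ∧ ‖f' z‖ ≤ √B := by
    simp only [hf']
    split_ifs with hz
    · exact hz
    · rw [Complex.norm_real, Real.norm_of_nonneg (Real.sqrt_nonneg A)]
      exact ⟨le_rfl, hAB⟩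
  have hff' : f =ᵐ[squareMeasure] quasiExtend f' := by
    filter_upwards [hbd, quasiExtend_ae_eq f'] with z hz hz2
    rw [hz2]
    simp only [hf']
    rw [if_pos (show z ∈ E from hz)]
  have hqm := stronglyMeasurable_quasiExtend hf'm
  have hqb (z : ℝ × ℝ) : √A ≤ ‖quasiExtend f' z‖ ∧ ‖quasiExtend f' z‖ ≤ √B := by
    rw [norm_quasiExtend]
    exact hf'b _
  have hg := memLp_zakInv hqm (memLp_of_bound hqm fun z => (hqb z).2)
  refine ⟨quasiExtend f', isQuasiPeriodic_quasiExtend f', hqm, hqb, hg, Lp.ext ?_⟩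
  exact ((zakInvIsometry_coeFn f).trans (zakInv_congr_ae hff')).trans hg.coeFn_toLp.symm

theorem exists_lower_bound (A B : ℝ) : ∃ C : ℝ, 0 < C ∧
    ∀ g : L2R, IsRieszBasisWithBounds (gaborSystem g) A B →
      ∀ R L : ℝ, 1 ≤ R → 1 ≤ L → C / (R * L) ≤ timeFreqTail g R L := by
  rcases le_or_gt A 0 with hA | hA
  · exact ⟨1, one_pos, fun g hg => absurd hg.1 (not_lt.2 hA)⟩
  obtain ⟨K, hK1, hK⟩ := exists_tail_bound (Real.sqrt_pos.2 hA) (√B)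
  refine ⟨√A ^ 2 / 144 / K ^ 2, by positivity, fun g hg R L hR hL => ?_⟩
  obtain ⟨F, hq, hF, hb, hm, rfl⟩ := exists_quasiPeriodic_of_isRieszBasisWithBounds hg
  have h := hK F hq hF hb hm R L hR hL
  rw [div_le_iff₀ (by positivity), div_le_iff₀ (by positivity)]
  linarith

/-! ### Tails and mean square differences -/

theorem norm_expi_sub_one_sq (t : ℝ) : ‖expi t - 1‖ ^ 2 = 2 - 2 * Real.cos (2 * Real.pi * t) := by
  have hc : expi t = (Real.cos (2 * Real.pi * t) : ℂ) + (Real.sin (2 * Real.pi * t) : ℂ) * Complex.I := by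
    rw [expi_eq, Complex.exp_mul_I]; push_cast; ring
  rw [hc, ← Complex.normSq_eq_norm_sq, Complex.normSq_apply]
  simp only [Complex.sub_re, Complex.sub_im, Complex.add_re, Complex.add_im, Complex.mul_re,
    Complex.mul_im, Complex.ofReal_re, Complex.ofReal_im, Complex.I_re, Complex.I_im, Complex.one_re,
    Complex.one_im]
  nlinarith [Real.sin_sq_add_cos_sq (2 * Real.pi * t)]

theorem norm_expi_neg_sub_one (t : ℝ) : ‖expi (-t) - 1‖ = ‖expi t - 1‖ := by
  have h : ‖expi (-t) - 1‖ ^ 2 = ‖expi t - 1‖ ^ 2 := by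
    rw [norm_expi_sub_one_sq, norm_expi_sub_one_sq, mul_neg, Real.cos_neg]
  exact (pow_left_inj₀ (norm_nonneg _) (norm_nonneg _) two_ne_zero).1 h

/-- The integrand is `2 - 2cos(2πth)`; its constant part contributes `2/R`, and the oscillating part
at most `1/(π|t|) ≤ 1/R` in absolute value. -/
theorem le_integral_norm_expi_sub_one_sq {R t : ℝ} (hR : 0 < R) (ht : R ≤ |t|) :
    1 / R ≤ ∫ h in (0 : ℝ)..(1 / R), ‖expi (h * t) - 1‖ ^ 2 := by
  have ht0 : t ≠ 0 := by rintro rfl; simp at ht; linarith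
  have hpi := Real.pi_pos
  have hk : 2 * Real.pi * t ≠ 0 := mul_ne_zero (by positivity) ht0
  have e (h : ℝ) : ‖expi (h * t) - 1‖ ^ 2 = 2 - 2 * Real.cos ((2 * Real.pi * t) * h) := by
    rw [norm_expi_sub_one_sq]; congr 3; ring
  simp only [e]
  rw [intervalIntegral.integral_sub (by simp) ((by fun_prop : Continuous fun h : ℝ =>
      2 * Real.cos ((2 * Real.pi * t) * h)).intervalIntegrable _ _),
    intervalIntegral.integral_const_mul, intervalIntegral.integral_comp_mul_left _ hk, integral_cos]
  simp only [intervalIntegral.integral_const, sub_zero, smul_eq_mul, mul_zero, Real.sin_zero]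
  set s := Real.sin (2 * Real.pi * t * (1 / R)) with hs
  have hs1 : |s| ≤ 1 := Real.abs_sin_le_one _
  have h1 : |2 * ((2 * Real.pi * t)⁻¹ * s)| ≤ 1 / R := by
    rw [abs_mul, abs_mul, abs_inv, abs_mul, abs_of_pos (by positivity : (0 : ℝ) < 2 * Real.pi),
      abs_two]
    calc 2 * ((2 * Real.pi * |t|)⁻¹ * |s|) ≤ 2 * ((2 * Real.pi * |t|)⁻¹ * 1) := by gcongr
      _ = 1 / (Real.pi * |t|) := by field_simp
      _ ≤ 1 / R := by
          apply one_div_le_one_div_of_le hR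
          nlinarith [Real.pi_gt_three, abs_nonneg t]
  have h2 := (abs_le.1 h1).2
  have h3 : 1 / R * 2 = 1 / R + 1 / R := by ring
  linarith

/-- Tails are controlled by moduli of continuity on the other side of the Fourier transform. -/
theorem setLIntegral_tail_le {k : ℝ → ℂ} (hk : AEMeasurable k volume) {R : ℝ} (hR : 0 < R)
    {D : ENNReal}
    (h : ∀ s, 0 < s → s ≤ 1 / R → ∫⁻ t, ‖expi (s * t) - 1‖ₑ ^ 2 * ‖k t‖ₑ ^ 2 ≤ D) :
    ∫⁻ t in {t : ℝ | R ≤ |t|}, ‖k t‖ₑ ^ 2 ≤ D := by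
  have hR' : (0 : ℝ) < 1 / R := one_div_pos.2 hR
  have hinner (t : ℝ) (ht : R ≤ |t|) :
      ENNReal.ofReal (1 / R) ≤ ∫⁻ s in Set.Ioc 0 (1 / R), ‖expi (s * t) - 1‖ₑ ^ 2 := by
    have hc : Continuous fun s => expi (s * t) - 1 := by fun_prop
    have hm : MemLp (fun s => expi (s * t) - 1) 2 (volume.restrict (Set.Ioc 0 (1 / R))) :=
      memLp_of_bound hc.stronglyMeasurable (b := 2) fun s => by
        refine (norm_sub_le _ _).trans ?_
        simp only [norm_expi, norm_one]; norm_num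
    rw [lintegral_enorm_sq_eq_ofReal hm, ← intervalIntegral.integral_of_le hR'.le]
    exact ENNReal.ofReal_le_ofReal (le_integral_norm_expi_sub_one_sq hR ht)
  have hjoint : AEMeasurable (Function.uncurry fun t s : ℝ => ‖expi (s * t) - 1‖ₑ ^ 2 * ‖k t‖ₑ ^ 2)
      (volume.prod (volume.restrict (Set.Ioc 0 (1 / R)))) := by
    have hm : Measurable fun p : ℝ × ℝ => ‖expi (p.2 * p.1) - 1‖ₑ ^ 2 := by fun_prop
    refine AEMeasurable.mul hm.aemeasurable ?_
    exact (hk.enorm.pow_const 2).comp_fst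
  have hmain : ENNReal.ofReal (1 / R) * ∫⁻ t in {t : ℝ | R ≤ |t|}, ‖k t‖ₑ ^ 2
      ≤ ENNReal.ofReal (1 / R) * D := by
    -- Averaging over steps `s` in `(0, 1/R]` removes the zeros of the individual multipliers;
    -- Tonelli then allows the hypothesis to be used for each `s`.
    calc ENNReal.ofReal (1 / R) * ∫⁻ t in {t : ℝ | R ≤ |t|}, ‖k t‖ₑ ^ 2
        = ∫⁻ t in {t : ℝ | R ≤ |t|}, ENNReal.ofReal (1 / R) * ‖k t‖ₑ ^ 2 :=
          (lintegral_const_mul' _ _ ENNReal.ofReal_ne_top).symm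
      _ ≤ ∫⁻ t in {t : ℝ | R ≤ |t|}, ∫⁻ s in Set.Ioc 0 (1 / R),
            ‖expi (s * t) - 1‖ₑ ^ 2 * ‖k t‖ₑ ^ 2 := by
          refine setLIntegral_mono' (measurableSet_le_abs R) fun t ht => ?_
          rw [lintegral_mul_const' _ _ (by simp)]
          gcongr
          exact hinner t ht
      _ ≤ ∫⁻ t, ∫⁻ s in Set.Ioc 0 (1 / R), ‖expi (s * t) - 1‖ₑ ^ 2 * ‖k t‖ₑ ^ 2 :=
          setLIntegral_le_lintegral _ _
      _ = ∫⁻ s in Set.Ioc 0 (1 / R), ∫⁻ t, ‖expi (s * t) - 1‖ₑ ^ 2 * ‖k t‖ₑ ^ 2 :=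
          lintegral_lintegral_swap hjoint
      _ ≤ ∫⁻ _ in Set.Ioc 0 (1 / R), D :=
          setLIntegral_mono' measurableSet_Ioc fun s hs => h s hs.1 hs.2
      _ = ENNReal.ofReal (1 / R) * D := by
          rw [setLIntegral_const, Real.volume_Ioc, sub_zero, mul_comm]
  exact (ENNReal.mul_le_mul_iff_right (by simpa using hR) ENNReal.ofReal_ne_top).1 hmain

/-- Makes the identities for `ℓ¹` combinations available for plain differences, which suffice for
the upper bound. -/
theorem tsum_difference_mul (x : ℤ → ℂ) :
    ∑' j : ℤ, ((if j = 1 then 1 else 0) - (if j = 0 then 1 else 0)) * x j = x 1 - x 0 := by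
  have hsing (k : ℤ) : HasSum (fun j => (if j = k then 1 else 0) * x j) (x k) := by
    refine (hasSum_ite_eq k (x k)).congr_fun fun j => ?_
    by_cases h : j = k <;> simp [h]
  refine HasSum.tsum_eq (((hsing 1).sub (hsing 0)).congr_fun fun j => ?_)
  ring

theorem summable_norm_difference :
    Summable fun j : ℤ => ‖((if j = 1 then 1 else 0) - (if j = 0 then 1 else 0) : ℂ)‖ := by
  refine summable_of_ne_finset_zero (s := {0, 1}) fun j hj => ?_
  simp only [Finset.mem_insert, Finset.mem_singleton, not_or] at hj
  simp [hj.1, hj.2]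

section Differences

variable {F : ℝ × ℝ → ℂ} {b : ℝ}

theorem lintegral_comp_add_fst_sub (hq : IsQuasiPeriodic F) (hF : StronglyMeasurable F)
    (hb : ∀ z, ‖F z‖ ≤ b) (hg : MemLp (zakInv F) 2 volume) (h : ℝ) :
    ∫⁻ z, ‖F (z.1 + h, z.2) - F z‖ₑ ^ 2 ∂squareMeasure
      = ∫⁻ ξ, ‖expi (h * ξ) - 1‖ₑ ^ 2 * ‖(𝓕 (hg.toLp (zakInv F)) : L2R) ξ‖ₑ ^ 2 := by
  have := lintegral_tsum_comp_add_fst hq hF hb summable_norm_difference hg h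
  simp only [tsum_difference_mul] at this
  simpa using this

theorem lintegral_modulate_sub (hq : IsQuasiPeriodic F) (hF : StronglyMeasurable F)
    (hb : ∀ z, ‖F z‖ ≤ b) (h : ℝ) :
    ∫⁻ z, ‖expi (-(h * z.1)) * F (z.1, z.2 + h) - F z‖ₑ ^ 2 ∂squareMeasure
      = ∫⁻ t, ‖expi (h * t) - 1‖ₑ ^ 2 * ‖zakInv F t‖ₑ ^ 2 := by
  have := lintegral_tsum_modulate hq hF hb summable_norm_difference h
  simp only [tsum_difference_mul] at this
  have e (t : ℝ) : ‖expi (-(h * t)) - 1‖ₑ = ‖expi (h * t) - 1‖ₑ := by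
    rw [← ofReal_norm, norm_expi_neg_sub_one, ofReal_norm]
  simpa [e] using this

end Differences

/-! ### The logarithmic integral -/

section Integrals

theorem integral_comp_abs_sub_half {φ : ℝ → ℝ} (hφ : ContinuousOn φ (Set.Ici 0)) :
    ∫ y in (0 : ℝ)..1, φ |y - 1 / 2| = 2 * ∫ s in (0 : ℝ)..(1 / 2), φ s := by
  have hc : Continuous fun y : ℝ => φ |y - 1 / 2| :=
    hφ.comp_continuous (by fun_prop) fun y => Set.mem_Ici.2 (abs_nonneg _)
  rw [← intervalIntegral.integral_add_adjacent_intervals (b := 1 / 2) (hc.intervalIntegrable _ _)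
    (hc.intervalIntegrable _ _)]
  have h1 : ∫ y in (0 : ℝ)..(1 / 2), φ |y - 1 / 2| = ∫ s in (0 : ℝ)..(1 / 2), φ s := by
    rw [intervalIntegral.integral_congr (g := fun y => φ (1 / 2 - y)),
      intervalIntegral.integral_comp_sub_left φ]
    · norm_num
    · intro y hy
      rw [Set.uIcc_of_le (by norm_num)] at hy
      simp only []
      rw [abs_of_nonpos (by linarith [hy.2]), neg_sub]
  have h2 : ∫ y in (1 / 2 : ℝ)..1, φ |y - 1 / 2| = ∫ s in (0 : ℝ)..(1 / 2), φ s := by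
    rw [intervalIntegral.integral_congr (g := fun y => φ (y - 1 / 2)),
      intervalIntegral.integral_comp_sub_right φ]
    · norm_num
    · intro y hy
      rw [Set.uIcc_of_le (by norm_num)] at hy
      simp only []
      rw [abs_of_nonneg (by linarith [hy.1])]
  rw [h1, h2]
  ring

theorem integral_inv_add_sq_le {α : ℝ} (hα : 0 < α) :
    ∫ s in (0 : ℝ)..(1 / 2), ((α + s) ^ 2)⁻¹ ≤ α⁻¹ := by
  have hpos (s : ℝ) (hs : s ∈ Set.uIcc (0 : ℝ) (1 / 2)) : 0 < α + s := by
    rw [Set.uIcc_of_le (by norm_num)] at hs; linarith [hs.1]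
  rw [intervalIntegral.integral_eq_sub_of_hasDerivAt (f := fun s => -(α + s)⁻¹)]
  · have : 0 < (α + 1 / 2)⁻¹ := by positivity
    simp only [add_zero]
    linarith
  · intro s hs
    have h := (((hasDerivAt_id s).const_add α).inv (hpos s hs).ne').neg
    refine h.congr_deriv ?_
    simp [neg_div]
  · refine ContinuousOn.intervalIntegrable fun s hs => ?_
    have hc : ContinuousAt (fun s : ℝ => (α + s) ^ 2) s := by fun_prop
    exact (hc.inv₀ (pow_pos (hpos s hs) 2).ne').continuousWithinAt

theorem integral_inv_add {η : ℝ} (hη : 0 < η) :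
    ∫ s in (0 : ℝ)..(1 / 2), (η + s)⁻¹ = Real.log (1 + 1 / (2 * η)) := by
  rw [intervalIntegral.integral_comp_add_left (fun s => s⁻¹), integral_inv_of_pos (by linarith)
    (by linarith)]
  congr 1
  field_simp
  ring

theorem lintegral_unitMeasure_ofReal {φ : ℝ → ℝ} (hφ : Continuous φ) (h0 : ∀ x, 0 ≤ φ x) :
    ∫⁻ x, ENNReal.ofReal (φ x) ∂unitMeasure = ENNReal.ofReal (∫ x in (0 : ℝ)..1, φ x) := by
  rw [intervalIntegral.integral_of_le zero_le_one, unitMeasure_eq_Ioc,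
    ofReal_integral_eq_lintegral_ofReal hφ.integrableOn_Ioc (Filter.Eventually.of_forall h0)]

/-- This is the source of the logarithm: the inverse square distance to a point barely fails to be
integrable in the plane, and `η` truncates it. -/
theorem lintegral_inv_add_sq_le {η : ℝ} (hη : 0 < η) :
    ∫⁻ z, ENNReal.ofReal (((η + |z.1 - 1 / 2| + |z.2 - 1 / 2|) ^ 2)⁻¹) ∂squareMeasure
      ≤ ENNReal.ofReal (4 * Real.log (1 + 1 / (2 * η))) := by
  have hc2 : Continuous fun z : ℝ × ℝ => ((η + |z.1 - 1 / 2| + |z.2 - 1 / 2|) ^ 2)⁻¹ :=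
    Continuous.inv₀ (by fun_prop) fun z => by positivity
  rw [lintegral_squareMeasure hc2.measurable.ennreal_ofReal.aemeasurable]
  have hinner (x : ℝ) :
      ∫⁻ y, ENNReal.ofReal (((η + |x - 1 / 2| + |y - 1 / 2|) ^ 2)⁻¹) ∂unitMeasure
        ≤ ENNReal.ofReal (2 * (η + |x - 1 / 2|)⁻¹) := by
    have hcx : Continuous fun y : ℝ => ((η + |x - 1 / 2| + |y - 1 / 2|) ^ 2)⁻¹ :=
      hc2.comp (Continuous.prodMk_right x)
    rw [lintegral_unitMeasure_ofReal hcx fun y => by positivity]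
    refine ENNReal.ofReal_le_ofReal ?_
    have hα : 0 < η + |x - 1 / 2| := by positivity
    rw [integral_comp_abs_sub_half (φ := fun s => ((η + |x - 1 / 2| + s) ^ 2)⁻¹)]
    · exact mul_le_mul_of_nonneg_left (integral_inv_add_sq_le hα) zero_le_two
    · intro s hs
      have : 0 < η + |x - 1 / 2| + s := by have : 0 ≤ s := hs; positivity
      have hc : ContinuousAt (fun s : ℝ => (η + |x - 1 / 2| + s) ^ 2) s := by fun_prop
      exact (hc.inv₀ (pow_pos this 2).ne').continuousWithinAt
  refine (lintegral_mono hinner).trans ?_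
  have hc1 : Continuous fun x : ℝ => 2 * (η + |x - 1 / 2|)⁻¹ :=
    continuous_const.mul (Continuous.inv₀ (by fun_prop) fun x => by positivity)
  rw [lintegral_unitMeasure_ofReal hc1 fun x => by positivity]
  refine ENNReal.ofReal_le_ofReal (le_of_eq ?_)
  rw [intervalIntegral.integral_const_mul,
    integral_comp_abs_sub_half (φ := fun s => (η + s)⁻¹), integral_inv_add hη]
  · ring
  · intro s hs
    have : 0 < η + s := by have : 0 ≤ s := hs; positivity
    have hc : ContinuousAt (fun s : ℝ => η + s) s := by fun_prop
    exact (hc.inv₀ this.ne').continuousWithinAt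

end Integrals

/-! ### The phase of the Zak transform of the hat function -/

/-- The Zak transform of the hat function on `[0, 1)²`. -/
noncomputable def hatZak (z : ℝ × ℝ) : ℂ := (1 - z.1) + z.1 * expi z.2

theorem continuous_hatZak : Continuous hatZak := by unfold hatZak; fun_prop

theorem two_mul_abs_sub_half_le_abs_cos {y : ℝ} (hy : y ∈ Set.Icc (0 : ℝ) 1) :
    2 * |y - 1 / 2| ≤ |Real.cos (Real.pi * y)| := by
  have hpi := Real.pi_pos
  have h1 : |y - 1 / 2| ≤ 1 / 2 := by rw [abs_le]; constructor <;> linarith [hy.1, hy.2]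
  have h2 := Real.mul_le_sin (x := Real.pi * |y - 1 / 2|) (by positivity) (by nlinarith)
  have e : 2 / Real.pi * (Real.pi * |y - 1 / 2|) = 2 * |y - 1 / 2| := by field_simp
  rw [e] at h2
  refine h2.trans ?_
  have h3 : Real.cos (Real.pi * y) = -Real.sin (Real.pi * (y - 1 / 2)) := by
    rw [← Real.cos_add_pi_div_two]; congr 1; ring
  rw [h3, abs_neg]
  rcases abs_choice (y - 1 / 2) with h | h <;> rw [h]
  · exact le_abs_self _
  · rw [mul_neg, Real.sin_neg]; exact neg_le_abs _

theorem norm_hatZak_sq (z : ℝ × ℝ) :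
    ‖hatZak z‖ ^ 2 = (1 - 2 * z.1) ^ 2
      + (1 - (1 - 2 * z.1) ^ 2) * Real.cos (Real.pi * z.2) ^ 2 := by
  have hc : expi z.2 = (Real.cos (2 * (Real.pi * z.2)) : ℂ)
      + (Real.sin (2 * (Real.pi * z.2)) : ℂ) * Complex.I := by
    rw [expi_eq, Complex.exp_mul_I]; push_cast; ring_nf
  have h1 := Real.sin_sq_add_cos_sq (2 * (Real.pi * z.2))
  have h2 := Real.cos_two_mul (Real.pi * z.2)
  rw [hatZak, hc, ← Complex.normSq_eq_norm_sq, Complex.normSq_apply]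
  simp only [Complex.sub_re, Complex.sub_im, Complex.add_re, Complex.add_im, Complex.mul_re,
    Complex.mul_im, Complex.ofReal_re, Complex.ofReal_im, Complex.I_re, Complex.I_im, Complex.one_re,
    Complex.one_im]
  rw [h2] at h1 ⊢
  linear_combination z.1 ^ 2 * h1

/-- With `u, w` the distances of the coordinates to `1/2`, the squared norm is at least `4u² + 4w² -
16u²w²`. Since `uw ≤ 1/4`, this is at least `4u² + 4w² - 4uw = (u + w)² + 3(u - w)²`. -/
theorem le_norm_hatZak {z : ℝ × ℝ} (h1 : z.1 ∈ Set.Icc (0 : ℝ) 1) (h2 : z.2 ∈ Set.Icc (0 : ℝ) 1) :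
    |z.1 - 1 / 2| + |z.2 - 1 / 2| ≤ ‖hatZak z‖ := by
  refine le_of_sq_le_sq ?_ (norm_nonneg _)
  have hv := two_mul_abs_sub_half_le_abs_cos h2
  have hv2 : (2 * |z.2 - 1 / 2|) ^ 2 ≤ Real.cos (Real.pi * z.2) ^ 2 := by
    rw [← sq_abs (Real.cos _)]
    exact pow_le_pow_left₀ (by positivity) hv 2
  have hu : (1 - 2 * z.1) ^ 2 = (2 * |z.1 - 1 / 2|) ^ 2 := by
    rw [mul_pow, sq_abs]; ring
  have hu1 : |z.1 - 1 / 2| ≤ 1 / 2 := by rw [abs_le]; constructor <;> linarith [h1.1, h1.2]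
  have hw1 : |z.2 - 1 / 2| ≤ 1 / 2 := by rw [abs_le]; constructor <;> linarith [h2.1, h2.2]
  rw [norm_hatZak_sq, hu]
  set u := |z.1 - 1 / 2|
  set w := |z.2 - 1 / 2|
  have hu0 : 0 ≤ u := abs_nonneg _
  have hw0 : 0 ≤ w := abs_nonneg _
  have h3 : 0 ≤ 1 - (2 * u) ^ 2 := by nlinarith
  have h4 := mul_le_mul_of_nonneg_left hv2 h3
  have h5 : u * w ≤ 1 / 4 := by nlinarith
  have h6 : (u * w) * (u * w) ≤ u * w * (1 / 4) := mul_le_mul_of_nonneg_left h5 (by positivity)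
  nlinarith [sq_nonneg (u - w)]

theorem norm_hatZak_le_one {z : ℝ × ℝ} (h1 : z.1 ∈ Set.Icc (0 : ℝ) 1) : ‖hatZak z‖ ≤ 1 := by
  have e : ‖(1 - z.1 : ℂ)‖ = 1 - z.1 := by
    rw [← Complex.ofReal_one, ← Complex.ofReal_sub, Complex.norm_real,
      Real.norm_of_nonneg (by linarith [h1.2])]
  calc ‖hatZak z‖ ≤ ‖(1 - z.1 : ℂ)‖ + ‖(z.1 : ℂ) * expi z.2‖ := norm_add_le _ _
    _ = 1 := by
      rw [e, norm_mul, norm_expi, Complex.norm_real, Real.norm_of_nonneg h1.1]; ring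

/-- The unimodular part of the Zak transform of the hat function on `[0, 1)²`. -/
noncomputable def hatPhase (z : ℝ × ℝ) : ℂ :=
  open Classical in if hatZak z = 0 then 1 else hatZak z / ‖hatZak z‖

theorem norm_hatPhase (z : ℝ × ℝ) : ‖hatPhase z‖ = 1 := by
  unfold hatPhase
  split_ifs with h
  · simp
  · rw [norm_div, Complex.norm_real, norm_norm, div_self (norm_ne_zero_iff.2 h)]

theorem hatPhase_mul_norm (z : ℝ × ℝ) : hatPhase z * ‖hatZak z‖ = hatZak z := by
  unfold hatPhase
  split_ifs with h
  · simp [h]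
  · exact div_mul_cancel₀ _ (by simpa using h)

theorem stronglyMeasurable_hatPhase : StronglyMeasurable hatPhase := by
  classical
  unfold hatPhase
  have hm := continuous_hatZak.measurable
  refine StronglyMeasurable.ite (hm (measurableSet_singleton 0)) stronglyMeasurable_const ?_
  exact (hm.div (Complex.measurable_ofReal.comp hm.norm)).stronglyMeasurable

theorem quasiExtend_hatPhase_mul_norm (z : ℝ × ℝ) :
    quasiExtend hatPhase z * ‖quasiExtend hatZak z‖ = quasiExtend hatZak z := by
  rw [norm_quasiExtend, quasiExtend, mul_assoc, hatPhase_mul_norm, quasiExtend]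

theorem norm_quasiExtend_hatPhase (z : ℝ × ℝ) : ‖quasiExtend hatPhase z‖ = 1 := by
  rw [norm_quasiExtend, norm_hatPhase]

/-- Converts a Lipschitz bound for a function into one for its phase, at the cost of dividing by the
modulus: `(u' - u)|w| = u'(|w| - |w'|) + (w' - w)`. -/
theorem norm_sub_mul_norm_le {u u' w w' : ℂ} (h : u * ‖w‖ = w) (h' : u' * ‖w'‖ = w')
    (hu : ‖u'‖ = 1) : ‖u' - u‖ * ‖w‖ ≤ 2 * ‖w' - w‖ := by
  have e : (u' - u) * (‖w‖ : ℂ) = u' * ((‖w‖ - ‖w'‖ : ℝ) : ℂ) + (w' - w) := by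
    push_cast
    linear_combination h' - h
  calc ‖u' - u‖ * ‖w‖ = ‖(u' - u) * (‖w‖ : ℂ)‖ := by rw [norm_mul, Complex.norm_real, norm_norm]
    _ ≤ ‖u' * ((‖w‖ - ‖w'‖ : ℝ) : ℂ)‖ + ‖w' - w‖ := by rw [e]; exact norm_add_le _ _
    _ = |‖w‖ - ‖w'‖| + ‖w' - w‖ := by rw [norm_mul, hu, one_mul, Complex.norm_real, Real.norm_eq_abs]
    _ ≤ ‖w' - w‖ + ‖w' - w‖ := by
        rw [abs_sub_comm]
        gcongr
        exact abs_norm_sub_norm_le _ _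
    _ = _ := by ring

theorem norm_expi_sub_one_le_two (y : ℝ) : ‖expi y - 1‖ ≤ 2 := by
  refine (norm_sub_le _ _).trans ?_
  simp only [norm_expi, norm_one]
  norm_num

theorem hatZak_fract (x y : ℝ) : hatZak (x, Int.fract y) = hatZak (x, y) := by
  have : expi (Int.fract y) = expi y := by
    conv_rhs => rw [← Int.fract_add_floor y, expi_add_intCast]
  simp [hatZak, this]

/-- The values at `x = 0` and `x = 1` are compatible with quasi-periodicity, so the extension has no
jump: past the edge the difference is `e^{2πiy} - 1` times a factor of norm at most `h`. -/
theorem norm_quasiExtend_hatZak_add_fst_sub_le {z : ℝ × ℝ} (h1 : z.1 ∈ Set.Ico (0 : ℝ) 1) {h : ℝ}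
    (h0 : 0 ≤ h) (hh : h ≤ 1) :
    ‖quasiExtend hatZak (z.1 + h, z.2) - quasiExtend hatZak z‖ ≤ 2 * h := by
  obtain ⟨x, y⟩ := z
  simp only [quasiExtend, hatZak_fract] at h1 ⊢
  rw [Int.floor_eq_zero_iff.2 h1, Int.fract_eq_self.2 h1]
  rcases lt_or_ge (x + h) 1 with hx | hx
  · have hm : x + h ∈ Set.Ico (0 : ℝ) 1 := ⟨by linarith [h1.1], hx⟩
    rw [Int.floor_eq_zero_iff.2 hm, Int.fract_eq_self.2 hm]
    have e : expi (((0 : ℤ) : ℝ) * y) * hatZak (x + h, y) - expi (((0 : ℤ) : ℝ) * y) * hatZak (x, y)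
        = h * (expi y - 1) := by
      simp only [hatZak, Int.cast_zero, zero_mul, expi_zero]; push_cast; ring
    rw [e, norm_mul, Complex.norm_real, Real.norm_of_nonneg h0, mul_comm]
    exact mul_le_mul_of_nonneg_right (norm_expi_sub_one_le_two y) h0
  · have hf : ⌊x + h⌋ = 1 := by
      rw [Int.floor_eq_iff]; push_cast; constructor <;> linarith [h1.2]
    have hfr : Int.fract (x + h) = x + h - 1 := by rw [Int.fract, hf]; push_cast; ring
    rw [hf, hfr]
    have e : expi (((1 : ℤ) : ℝ) * y) * hatZak (x + h - 1, y)
        - expi (((0 : ℤ) : ℝ) * y) * hatZak (x, y)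
        = (expi y - 1) * (((1 - x : ℝ) : ℂ) + ((x + h - 1 : ℝ) : ℂ) * expi y) := by
      simp only [hatZak, Int.cast_zero, zero_mul, expi_zero, Int.cast_one, one_mul]; push_cast; ring
    rw [e, norm_mul]
    refine mul_le_mul (norm_expi_sub_one_le_two y) ?_ (norm_nonneg _) zero_le_two
    refine (norm_add_le _ _).trans (le_of_eq ?_)
    rw [norm_mul, norm_expi, Complex.norm_real, Complex.norm_real,
      Real.norm_of_nonneg (by linarith [h1.2]), Real.norm_of_nonneg (by linarith)]
    ring

/-- The modulation and the shift in `y` each cost at most `2πh`, and `4π < 14`. -/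
theorem norm_modulate_hatZak_sub_le {z : ℝ × ℝ} (h1 : z.1 ∈ Set.Ico (0 : ℝ) 1) {h : ℝ}
    (h0 : 0 ≤ h) :
    ‖expi (-(h * z.1)) * quasiExtend hatZak (z.1, z.2 + h) - quasiExtend hatZak z‖ ≤ 14 * h := by
  obtain ⟨x, y⟩ := z
  simp only [quasiExtend, hatZak_fract] at h1 ⊢
  rw [Int.floor_eq_zero_iff.2 h1, Int.fract_eq_self.2 h1]
  simp only [Int.cast_zero, zero_mul, expi_zero, one_mul]
  have e : expi (-(h * x)) * hatZak (x, y + h) - hatZak (x, y)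
      = (expi (-(h * x)) - 1) * hatZak (x, y + h) + x * (expi y * (expi h - 1)) := by
    simp only [hatZak, expi_add]; ring
  have hpi := Real.pi_lt_d2
  have hpi0 := Real.pi_pos
  have b1 : ‖(expi (-(h * x)) - 1) * hatZak (x, y + h)‖ ≤ (2 * Real.pi * h) * 1 := by
    rw [norm_mul]
    refine mul_le_mul ?_ (norm_hatZak_le_one ⟨h1.1, h1.2.le⟩) (norm_nonneg _) (by positivity)
    refine (norm_expi_sub_one_le _).trans ?_
    rw [abs_neg, abs_of_nonneg (mul_nonneg h0 h1.1)]
    exact mul_le_mul_of_nonneg_left (mul_le_of_le_one_right h0 h1.2.le) (by positivity)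
  have b2 : ‖(x : ℂ) * (expi y * (expi h - 1))‖ ≤ 1 * (2 * Real.pi * h) := by
    rw [norm_mul, norm_mul, norm_expi, one_mul, Complex.norm_real, Real.norm_of_nonneg h1.1]
    refine mul_le_mul h1.2.le ?_ (norm_nonneg _) zero_le_one
    refine (norm_expi_sub_one_le _).trans (le_of_eq ?_)
    rw [abs_of_nonneg h0]
  rw [e]
  refine (norm_add_le _ _).trans ?_
  nlinarith

/-- Square means of differences of the phase. -/
theorem lintegral_phase_difference_le {P : ℝ × ℝ → ℂ} {G : ℝ × ℝ → ℂ} {η : ℝ} (hη : 0 < η)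
    (hP : ∀ z, ‖P z‖ = 1) (hPG : ∀ z, P z * ‖G z‖ = G z)
    (hG : ∀ z, z.1 ∈ Set.Ico (0 : ℝ) 1 → ‖G z - quasiExtend hatZak z‖ ≤ 14 * η) :
    ∫⁻ z, ‖P z - quasiExtend hatPhase z‖ₑ ^ 2 ∂squareMeasure
      ≤ ENNReal.ofReal (3600 * η ^ 2 * Real.log (1 + 1 / (2 * η))) := by
  have hpt : ∀ᵐ z ∂squareMeasure, ‖P z - quasiExtend hatPhase z‖ₑ ^ 2
      ≤ ENNReal.ofReal (900 * η ^ 2) *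
        ENNReal.ofReal (((η + |z.1 - 1 / 2| + |z.2 - 1 / 2|) ^ 2)⁻¹) := by
    filter_upwards [ae_squareMeasure_mem] with z hz
    have hρ := le_norm_hatZak (Set.Ico_subset_Icc_self hz.1) (Set.Ico_subset_Icc_self hz.2)
    rw [← quasiExtend_of_mem hatZak hz.1 hz.2] at hρ
    have h1 := norm_sub_mul_norm_le (quasiExtend_hatPhase_mul_norm z) (hPG z) (hP z)
    have h2 := hG z hz.1
    have h3 : ‖P z - quasiExtend hatPhase z‖ ≤ 2 := by
      refine (norm_sub_le _ _).trans ?_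
      rw [hP, norm_quasiExtend_hatPhase]
      norm_num
    set q := ‖P z - quasiExtend hatPhase z‖ with hq
    set ρ := η + |z.1 - 1 / 2| + |z.2 - 1 / 2| with hρdef
    have hρ0 : 0 < ρ := by positivity
    have hq0 : 0 ≤ q := norm_nonneg _
    -- Away from the zero, `q` times the modulus is at most `28η`; near it, the trivial bound `q ≤
    -- 2` contributes `2η`.
    have h4 : q * ρ ≤ 30 * η := by nlinarith
    rw [← ofReal_norm, ← hq, ← ENNReal.ofReal_pow hq0, ← ENNReal.ofReal_mul (by positivity)]
    refine ENNReal.ofReal_le_ofReal ?_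
    rw [← div_eq_mul_inv, le_div_iff₀ (by positivity), ← mul_pow]
    calc (q * ρ) ^ 2 ≤ (30 * η) ^ 2 := pow_le_pow_left₀ (by positivity) h4 2
      _ = 900 * η ^ 2 := by ring
  refine (lintegral_mono_ae hpt).trans ?_
  rw [lintegral_const_mul' _ _ ENNReal.ofReal_ne_top]
  refine (mul_le_mul_right (lintegral_inv_add_sq_le hη) _).trans (le_of_eq ?_)
  rw [← ENNReal.ofReal_mul (by positivity)]
  congr 1
  ring

theorem exists_orthonormalBasis_small_tail : ∃ g : L2R, IsOrthonormalBasis (gaborSystem g) ∧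
    ∃ C₀ : ℝ, 0 < C₀ ∧ ∀ C : ℝ, C₀ ≤ C →
      ∀ R : ℝ, 2 ≤ R → timeFreqTail g R R < C * Real.log (R * R) / (R * R) := by
  set F := quasiExtend hatPhase with hFdef
  have hq : IsQuasiPeriodic F := isQuasiPeriodic_quasiExtend _
  have hF : StronglyMeasurable F := stronglyMeasurable_quasiExtend stronglyMeasurable_hatPhase
  have h1 (z : ℝ × ℝ) : ‖F z‖ = 1 := norm_quasiExtend_hatPhase z
  have hb (z : ℝ × ℝ) : ‖F z‖ ≤ 1 := (h1 z).le
  have hF2 : MemLp F 2 squareMeasure := memLp_of_bound hF hb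
  have hg : MemLp (zakInv F) 2 volume := memLp_zakInv hF hF2
  have hgeq : zakInvEquiv (hF2.toLp F) = hg.toLp (zakInv F) :=
    Lp.ext ((zakInvEquiv_toLp_coeFn hF2).trans hg.coeFn_toLp.symm)
  -- Time and frequency tails contribute `3600` each; one more unit makes the inequality strict.
  refine ⟨hg.toLp (zakInv F), hgeq ▸ isOrthonormalBasis_gaborSystem hF2 h1, 7201, by norm_num,
    fun C hC R hR => ?_⟩
  have hR0 : 0 < R := by linarith
  have hη : 0 < 1 / R := one_div_pos.2 hR0
  have hη1 : 1 / R ≤ 1 := by rw [div_le_one hR0]; linarith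
  set D := ENNReal.ofReal (3600 * (1 / R) ^ 2 * Real.log (1 + 1 / (2 * (1 / R)))) with hD
  have hfreq : ∫⁻ ξ in {ξ : ℝ | R ≤ |ξ|}, ‖(𝓕 (hg.toLp (zakInv F)) : L2R) ξ‖ₑ ^ 2 ≤ D := by
    refine setLIntegral_tail_le (Lp.aestronglyMeasurable _).aemeasurable hR0 fun h h0 hh => ?_
    rw [← lintegral_comp_add_fst_sub hq hF hb hg]
    refine lintegral_phase_difference_le (P := fun z => F (z.1 + h, z.2))
      (G := fun z => quasiExtend hatZak (z.1 + h, z.2)) hη (fun z => h1 _)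
      (fun z => quasiExtend_hatPhase_mul_norm _) fun z hz => ?_
    exact (norm_quasiExtend_hatZak_add_fst_sub_le hz h0.le (hh.trans hη1)).trans (by linarith)
  have htime : ∫⁻ t in {t : ℝ | R ≤ |t|}, ‖hg.toLp (zakInv F) t‖ₑ ^ 2 ≤ D := by
    have e : ∫⁻ t in {t : ℝ | R ≤ |t|}, ‖hg.toLp (zakInv F) t‖ₑ ^ 2
        = ∫⁻ t in {t : ℝ | R ≤ |t|}, ‖zakInv F t‖ₑ ^ 2 := by
      refine lintegral_congr_ae (ae_restrict_of_ae ?_)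
      filter_upwards [hg.coeFn_toLp] with t ht
      rw [ht]
    rw [e]
    refine setLIntegral_tail_le hg.1.aemeasurable hR0 fun h h0 hh => ?_
    rw [← lintegral_modulate_sub hq hF hb]
    refine lintegral_phase_difference_le
      (P := fun z => expi (-(h * z.1)) * F (z.1, z.2 + h))
      (G := fun z => expi (-(h * z.1)) * quasiExtend hatZak (z.1, z.2 + h)) hη
      (fun z => by rw [norm_mul, norm_expi, one_mul, h1]) (fun z => ?_) fun z hz => ?_
    · rw [norm_mul, norm_expi, one_mul, mul_assoc, hFdef, quasiExtend_hatPhase_mul_norm]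
    · exact (norm_modulate_hatZak_sub_le hz h0.le).trans (by linarith)
  have hlog : 0 < Real.log (R * R) := Real.log_pos (by nlinarith)
  -- The argument of the logarithm is `1 + R/2`, which is at most `R²` because `R ≥ 2`.
  have hlog1 : Real.log (1 + 1 / (2 * (1 / R))) ≤ Real.log (R * R) := by
    refine Real.log_le_log (by positivity) ?_
    have : 1 / (2 * (1 / R)) = R / 2 := by field_simp
    rw [this]
    nlinarith
  have htail : timeFreqTail (hg.toLp (zakInv F)) R R
      ≤ 2 * (3600 * (1 / R) ^ 2 * Real.log (1 + 1 / (2 * (1 / R)))) := by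
    have hlog0 : 0 ≤ Real.log (1 + 1 / (2 * (1 / R))) :=
      Real.log_nonneg (by have : 0 < 1 / (2 * (1 / R)) := by positivity
                          linarith)
    rw [← ENNReal.ofReal_le_ofReal_iff (by positivity), ofReal_timeFreqTail,
      ENNReal.ofReal_mul zero_le_two, ENNReal.ofReal_ofNat, two_mul]
    exact add_le_add htime hfreq
  calc timeFreqTail (hg.toLp (zakInv F)) R R
      ≤ 2 * (3600 * (1 / R) ^ 2 * Real.log (1 + 1 / (2 * (1 / R)))) := htail
    _ ≤ 2 * (3600 * (1 / R) ^ 2 * Real.log (R * R)) := by gcongr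
    _ = 7200 * Real.log (R * R) / (R * R) := by field_simp; ring
    _ < C * Real.log (R * R) / (R * R) := by
        gcongr
        linarith

theorem theorem1 :
    (∀ A B : ℝ, ∃ C : ℝ, 0 < C ∧
      ∀ g : L2R, IsRieszBasisWithBounds (gaborSystem g) A B →
        ∀ R L : ℝ, 1 ≤ R → 1 ≤ L → C / (R * L) ≤ timeFreqTail g R L) ∧
    (∃ g : L2R, IsOrthonormalBasis (gaborSystem g) ∧
      ∃ C₀ : ℝ, 0 < C₀ ∧ ∀ C : ℝ, C₀ ≤ C →
        ∀ R : ℝ, 2 ≤ R → timeFreqTail g R R < C * Real.log (R * R) / (R * R)) :=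
  ⟨exists_lower_bound, exists_orthonormalBasis_small_tail⟩
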